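/- Let $G$ be a finite simple graph and let $M$ be a matching of $G$. A walk is \emph{$M$-alternating} if, of any two consecutive edges, exactly one belongs to $M$; it is \emph{$mm$-alternating} if moreover it has at least one edge and its first and last edges belong to $M$. An \emph{$M$-blossom} is an odd cycle of length $2k+1$ in $G$ containing exactly $k$ edges of $M$; its \emph{base} is its unique vertex that is not matched by $M$ to another vertex of the cycle. Let $M$ be a maximum matching of $G$. An \emph{$M$-Jposy} consists of two (not necessarily distinct) $M$-blossoms together with an odd-length $mm$-alternating walk whose endpoints are the bases of the two blossoms. An \emph{$M$-Tposy} consists of two distinct (not necessarily disjoint) $M$-blossoms together with an odd-length $mm$-alternating path whose endpoints are the bases of the two blossoms and none of whose internal vertices lies on either blossom. The graph $G$ is a \emph{Jposy-graph} if it has a perfect matching $M$ and an $M$-Jposy that uses all the vertices and all the edges of $G$. \textbf{Theorem.} Let $G$ be a Jposy-graph. Then for every vertex $v$ of $G$ there is a maximum matching $M'$ of $G$ such that $v$ belongs to (a blossom or the path of) an $M'$-Tposy of $G$. -/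

import Mathlib

namespace JposyGraphs

variable {V : Type*} {G : SimpleGraph V}

/-- A maximum matching of `G`: a matching with the largest possible number of edges. -/
def IsMaximumMatching (M : G.Subgraph) : Prop :=
  M.IsMatching ∧ ∀ M' : G.Subgraph, M'.IsMatching → M'.edgeSet.ncard ≤ M.edgeSet.ncard

/-- Of any two consecutive edges of the walk, exactly one belongs to `M`. -/
def IsAlternatingWalk (M : G.Subgraph) {u v : V} (w : G.Walk u v) : Prop :=
  w.edges.IsChain fun e f => (e ∈ M.edgeSet ↔ f ∉ M.edgeSet)

/-- An alternating walk (with at least one edge) whose first and last edges are in `M`. -/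
def IsMMAlternating (M : G.Subgraph) {u v : V} (w : G.Walk u v) : Prop :=
  IsAlternatingWalk M w ∧
    (∃ e ∈ w.edges.head?, e ∈ M.edgeSet) ∧ (∃ e ∈ w.edges.getLast?, e ∈ M.edgeSet)

/-- `C` is an `M`-blossom with base `b`: an odd cycle of length `2 * k + 1` having exactly `k`
edges in `M`, traversed from the vertex `b` which `M` does not match to a vertex of the cycle. -/
def IsBlossom (M : G.Subgraph) {b : V} (C : G.Walk b b) : Prop :=
  C.IsCycle ∧
    (∃ k : ℕ, C.length = 2 * k + 1 ∧ {e | e ∈ C.edges ∧ e ∈ M.edgeSet}.ncard = k) ∧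
    ∀ v ∈ C.support, ¬ M.Adj b v

/-- `B₁`, `B₂`, `W` form an `M`-Jposy: two blossoms, possibly equal, whose bases are joined by an
`mm`-alternating walk of odd length. -/
def IsJposy (M : G.Subgraph) {a b : V}
    (B₁ : G.Walk a a) (B₂ : G.Walk b b) (W : G.Walk a b) : Prop :=
  IsMaximumMatching M ∧ IsBlossom M B₁ ∧ IsBlossom M B₂ ∧ IsMMAlternating M W ∧ Odd W.length

/-- `B₁`, `B₂`, `P` form an `M`-posy: two distinct blossoms, not necessarily disjoint, whose bases
are joined by an `mm`-alternating path of odd length. -/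
def IsPosy (M : G.Subgraph) {a b : V}
    (B₁ : G.Walk a a) (B₂ : G.Walk b b) (P : G.Walk a b) : Prop :=
  IsMaximumMatching M ∧ IsBlossom M B₁ ∧ IsBlossom M B₂ ∧ B₁.toSubgraph ≠ B₂.toSubgraph ∧
    P.IsPath ∧ IsMMAlternating M P ∧ Odd P.length

/-- An `M`-Tposy: an `M`-posy no internal vertex of whose path lies on one of its blossoms. -/
def IsTposy (M : G.Subgraph) {a b : V}
    (B₁ : G.Walk a a) (B₂ : G.Walk b b) (P : G.Walk a b) : Prop :=
  IsPosy M B₁ B₂ P ∧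
    ∀ v ∈ P.support, v ≠ a → v ≠ b → v ∉ B₁.support ∧ v ∉ B₂.support

/-- The vertex `v` belongs to some `M`-Tposy of `G`. -/
def MemTposy (M : G.Subgraph) (v : V) : Prop :=
  ∃ (a b : V) (B₁ : G.Walk a a) (B₂ : G.Walk b b) (P : G.Walk a b),
    IsTposy M B₁ B₂ P ∧ (v ∈ B₁.support ∨ v ∈ B₂.support ∨ v ∈ P.support)

/-- `G` is a Jposy-graph: for some perfect matching `M` there is an `M`-Jposy that uses all the
vertices and all the edges of `G`. -/
def IsJposyGraph (G : SimpleGraph V) : Prop :=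
  ∃ M : G.Subgraph, M.IsPerfectMatching ∧
    ∃ (a b : V) (B₁ : G.Walk a a) (B₂ : G.Walk b b) (W : G.Walk a b),
      IsJposy M B₁ B₂ W ∧
      (∀ v : V, v ∈ B₁.support ∨ v ∈ B₂.support ∨ v ∈ W.support) ∧
      ∀ e ∈ G.edgeSet, e ∈ B₁.edges ∨ e ∈ B₂.edges ∨ e ∈ W.edges

end JposyGraphs

/-! ### Alternating walks coded by the matching edges they cross -/

namespace JposyGraphs

variable {V : Type*} {G : SimpleGraph V} {μ : V → V}

/-! Read a perfect matching as an involution `μ` and put an arc from `u` to `w` when `u` is adjacent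
to `μ w`. Paths of this digraph are alternating walks, and `μ` reverses arcs, as negation does in
the implication graph of a 2-SAT formula. A blossom at `a` is a path from `a` to `μ a`; the walk of
the Jposy leads from `μ a` to `b`, and backwards from `μ b` to `a`. Hence the Jposy puts `a`, `μ a`,
`b`, `μ b` and all its vertices into one strong component, and every `v` reaches `μ v` and
conversely (`IsJposy.reach_mate`). So there are closed alternating walks at `v` and at `μ v` that
begin and end outside the matching.

To make a Tposy through `v` out of them, consider an alternating cycle through `v` with two exits,
one from a black vertex (one listed in the code of the cycle) and one from a white vertex (a partner
of a listed one). An exit is an ear returning to its own colour, or a stem with a blossom at its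
end. At the start the cycle is degenerate, namely the matching edge of `v` alone; this is allowed
because the coded walks only require adjacency for their "non-matching" steps. Exchanging the
matching along the cycle makes either arc between the two exit vertices an alternating path with
matching edges at its ends, so one may choose an arc through `v` (`exists_orient`).

If the exits are disjoint, a case analysis on where they end gives a Tposy (`HasTposy.of_disjoint`).
If they meet, either a Tposy appears at once, or the chosen arc and the initial pieces of both exits
form a new cycle through `v`, and the remainders are exits of a smaller configuration
(`HasTposy.of_meet`). Induction on size finishes (`tposyBelow`). The two blossoms of a Tposy may
overlap, which is why each blossom only has to be disjoint from the path. -/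

/-- `μ` sends every vertex to its partner in a perfect matching of `G`. -/
structure IsMate (G : SimpleGraph V) (μ : V → V) : Prop where
  invol : ∀ x, μ (μ x) = x
  adj : ∀ x, G.Adj x (μ x)

/-- `NN G μ x t y`: an alternating walk from `x` to `y` whose first and last edges are not matching
edges; its matching edges are the edges from `μ u` to `u`, for `u` running through `t`. -/
def NN (G : SimpleGraph V) (μ : V → V) : V → List V → V → Prop
  | x, [], y => G.Adj x y
  | x, u :: t, y => G.Adj x (μ u) ∧ NN G μ u t y

/-- `NM G μ x t y`: an alternating walk from `x` to `y`, empty or starting with a non-matching edge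
and ending with a matching edge; its matching edges are those from `μ u` to `u`, for `u` in `t`. -/
def NM (G : SimpleGraph V) (μ : V → V) : V → List V → V → Prop
  | x, [], y => x = y
  | x, u :: t, y => G.Adj x (μ u) ∧ NM G μ u t y

/-- The same matching edges, traversed backwards. -/
def inv (μ : V → V) (t : List V) : List V := (t.map μ).reverse

theorem NM.append {a b d : V} {l l' : List V} (h : NM G μ a l b) (h' : NM G μ b l' d) :
    NM G μ a (l ++ l') d := by
  induction l generalizing a with
  | nil => cases h; exact h'
  | cons u l ih => exact ⟨h.1, ih h.2⟩

theorem NM.append_nn {a b y : V} {l t : List V} (h : NM G μ a l b) (h' : NN G μ b t y) :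
    NN G μ a (l ++ t) y := by
  induction l generalizing a with
  | nil => cases h; exact h'
  | cons u l ih => exact ⟨h.1, ih h.2⟩

theorem NN.glue {a u w y : V} {t t' : List V} (h : NN G μ a t w) (hw : w = μ u)
    (h' : NN G μ u t' y) : NN G μ a (t ++ u :: t') y := by
  subst hw
  induction t generalizing a with
  | nil => exact ⟨h, h'⟩
  | cons b t ih => exact ⟨h.1, ih h.2⟩

theorem NN.split_cons {a u y : V} {t t' : List V} (h : NN G μ a (t ++ u :: t') y) :
    NN G μ a t (μ u) ∧ NN G μ u t' y := by
  induction t generalizing a with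
  | nil => exact h
  | cons b t ih => exact ⟨⟨h.1, (ih h.2).1⟩, (ih h.2).2⟩

theorem NN.inv {a b : V} {t : List V} (hμ : IsMate G μ) (h : NN G μ a t b) :
    NN G μ b (inv μ t) a := by
  induction t generalizing a with
  | nil => exact h.symm
  | cons u t ih =>
    have := (ih h.2).glue (u := μ u) (t' := []) (hμ.invol u).symm h.1.symm
    simpa [JposyGraphs.inv] using this

theorem NN.split_mem {a b x : V} {L : List V} (h : NN G μ a L b) (hx : x ∈ a :: L) :
    ∃ l q, L = l ++ q ∧ NM G μ a l x ∧ NN G μ x q b := by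
  induction L generalizing a with
  | nil => simp at hx; subst hx; exact ⟨[], [], rfl, rfl, h⟩
  | cons u L ih =>
    rcases List.mem_cons.1 hx with rfl | hx
    · exact ⟨[], _, rfl, rfl, h⟩
    · obtain ⟨l, q, rfl, h1, h2⟩ := ih h.2 hx
      exact ⟨u :: l, q, rfl, ⟨h.1, h1⟩, h2⟩

theorem NM.split_mem {a b x : V} {L : List V} (h : NM G μ a L b) (hx : x ∈ a :: L) :
    ∃ l q, L = l ++ q ∧ NM G μ a l x ∧ NM G μ x q b := by
  induction L generalizing a with
  | nil => simp at hx; subst hx; exact ⟨[], [], rfl, rfl, h⟩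
  | cons u L ih =>
    rcases List.mem_cons.1 hx with rfl | hx
    · exact ⟨[], _, rfl, rfl, h⟩
    · obtain ⟨l, q, rfl, h1, h2⟩ := ih h.2 hx
      exact ⟨u :: l, q, rfl, ⟨h.1, h1⟩, h2⟩

theorem NM.last {a b : V} {l : List V} (h : NM G μ a l b) :
    (l = [] ∧ a = b) ∨ ∃ m, l = m ++ [b] ∧ NN G μ a m (μ b) := by
  induction l generalizing a with
  | nil => exact Or.inl ⟨rfl, h⟩
  | cons u l ih =>
    rcases ih h.2 with ⟨rfl, rfl⟩ | ⟨m, rfl, hm⟩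
    · exact Or.inr ⟨[], rfl, h.1⟩
    · exact Or.inr ⟨u :: m, rfl, h.1, hm⟩

theorem NM.mem {a b : V} {l : List V} (h : NM G μ a l b) : b ∈ a :: l := by
  rcases h.last with ⟨_, rfl⟩ | ⟨m, rfl, _⟩ <;> simp

theorem NN.congr {a b : V} {t : List V} {μ' : V → V} (h : NN G μ a t b)
    (hc : ∀ z ∈ t, μ' z = μ z) : NN G μ' a t b := by
  induction t generalizing a with
  | nil => exact h
  | cons u t ih =>
    exact ⟨by rw [hc u (by simp)]; exact h.1, ih h.2 fun z hz => hc z (by simp [hz])⟩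

theorem mem_inv (hμ : IsMate G μ) {l : List V} {z : V} : z ∈ inv μ l ↔ μ z ∈ l := by
  simp only [inv, List.mem_reverse, List.mem_map]
  exact ⟨fun ⟨a, ha, h⟩ => by rwa [← h, hμ.invol], fun h => ⟨_, h, hμ.invol z⟩⟩

theorem NM.inv {a b : V} {l : List V} (hμ : IsMate G μ) (h : NM G μ a l b) :
    ∃ r, NM G μ (μ b) r (μ a) ∧ μ b :: r = JposyGraphs.inv μ (a :: l) := by
  induction l generalizing a with
  | nil => cases h; exact ⟨[], rfl, rfl⟩
  | cons u l ih =>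
    obtain ⟨r, h1, h2⟩ := ih h.2
    refine ⟨r ++ [μ a], h1.append (l' := [μ a]) ⟨by rw [hμ.invol]; exact h.1.symm, rfl⟩, ?_⟩
    rw [← List.cons_append, h2]
    simp [JposyGraphs.inv]

/-! ### Disjointness as arithmetic of covering multiplicities -/

section Cover

variable [DecidableEq V]

/-- How often `z` is an endpoint of the matching edge of `a`. -/
def hit (μ : V → V) (a z : V) : ℕ := (if a = z then 1 else 0) + if μ a = z then 1 else 0

/-- How often `z` is an endpoint of the matching edges of the vertices in a list. -/
def cov (μ : V → V) : List V → V → ℕ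
  | [], _ => 0
  | a :: l, z => hit μ a z + cov μ l z

/-- The matching edges of the vertices in a list are pairwise distinct. -/
def Simple (μ : V → V) (l : List V) : Prop := ∀ z, cov μ l z ≤ 1

theorem cov_nil (z : V) : cov μ [] z = 0 := rfl

theorem cov_cons (a : V) (l : List V) (z : V) : cov μ (a :: l) z = hit μ a z + cov μ l z := rfl

theorem cov_append (l l' : List V) (z : V) : cov μ (l ++ l') z = cov μ l z + cov μ l' z := by
  induction l with
  | nil => simp [cov]
  | cons a l ih => simp [cov, ih, add_assoc]

theorem cov_reverse (l : List V) (z : V) : cov μ l.reverse z = cov μ l z := by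
  induction l with
  | nil => rfl
  | cons a l ih => simp [cov, cov_append, ih, add_comm]

theorem hit_mate (hμ : IsMate G μ) (a z : V) : hit μ (μ a) z = hit μ a z := by
  simp [hit, hμ.invol, add_comm]

theorem cov_map (hμ : IsMate G μ) (l : List V) (z : V) : cov μ (l.map μ) z = cov μ l z := by
  induction l with
  | nil => rfl
  | cons a l ih => simp [cov, ih, hit_mate hμ]

theorem cov_inv (hμ : IsMate G μ) (l : List V) (z : V) : cov μ (inv μ l) z = cov μ l z := by
  rw [inv, cov_reverse, cov_map hμ]

theorem cov_eq_count (l : List V) (z : V) : cov μ l z = l.count z + (l.map μ).count z := by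
  induction l with
  | nil => rfl
  | cons a l ih => simp only [cov, ih, hit, List.count_cons, List.map_cons, beq_iff_eq]; omega

theorem cov_congr {μ' : V → V} {l : List V} (h : ∀ z ∈ l, μ' z = μ z) (z : V) :
    cov μ' l z = cov μ l z := by
  rw [cov_eq_count, cov_eq_count, List.map_congr_left h]

theorem cov_pos_of_mem {l : List V} {z : V} (h : z ∈ l) : 1 ≤ cov μ l z := by
  have := List.count_pos_iff.2 h
  rw [cov_eq_count]; omega

theorem cov_pos_of_mate_mem (hμ : IsMate G μ) {l : List V} {z : V} (h : μ z ∈ l) :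
    1 ≤ cov μ l z := by
  have : z ∈ l.map μ := List.mem_map.2 ⟨_, h, hμ.invol z⟩
  have := List.count_pos_iff.2 this
  rw [cov_eq_count]; omega

theorem mem_or_mate_mem (hμ : IsMate G μ) {l : List V} {z : V} (h : 1 ≤ cov μ l z) :
    z ∈ l ∨ μ z ∈ l := by
  rw [cov_eq_count] at h
  rcases Nat.lt_or_ge 0 (l.count z) with h1 | h1
  · exact Or.inl (List.count_pos_iff.1 h1)
  · have : z ∈ l.map μ := List.count_pos_iff.1 (by omega)
    obtain ⟨a, ha, rfl⟩ := List.mem_map.1 this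
    exact Or.inr (by rwa [hμ.invol])

theorem hit_self (a : V) : 1 ≤ hit μ a a := by simp [hit]

theorem hit_mate_self (a : V) : 1 ≤ hit μ a (μ a) := by simp [hit]

theorem Simple.nodup {l : List V} (h : Simple μ l) : l.Nodup :=
  List.nodup_iff_count_le_one.2 fun z => by have := h z; rw [cov_eq_count] at this; omega

theorem Simple.mate_notMem (hμ : IsMate G μ) {l : List V} (h : Simple μ l) {z : V} (hz : z ∈ l) :
    μ z ∉ l := fun hz' => by
  have h1 := h z
  have h2 := List.count_pos_iff.2 hz
  have : z ∈ l.map μ := List.mem_map.2 ⟨_, hz', hμ.invol z⟩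
  have h3 := List.count_pos_iff.2 this
  rw [cov_eq_count] at h1; omega

/-- The first vertex at which extending a simple list fails. -/
theorem exists_first_hit {L Z : List V} (hL : Simple μ L) (hZ : ¬ Simple μ (L ++ Z))
    (hμ : IsMate G μ) :
    ∃ A u B, Z = A ++ u :: B ∧ Simple μ (L ++ A) ∧ (u ∈ L ++ A ∨ μ u ∈ L ++ A) := by
  induction Z generalizing L with
  | nil => simp [hL] at hZ
  | cons u Z ih =>
    by_cases h : Simple μ (L ++ [u])
    · obtain ⟨A, u', B, rfl, h1, h2⟩ := ih (L := L ++ [u]) h (by simpa using hZ)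
      exact ⟨u :: A, u', B, rfl, by simpa using h1, by simpa using h2⟩
    · refine ⟨[], u, Z, rfl, by simpa using hL, ?_⟩
      by_contra hn
      apply h
      intro z
      simp only [cov_append, cov_cons, cov_nil]
      have h1 := hL z
      by_cases hz : 1 ≤ cov μ L z
      · have : hit μ u z = 0 := by
          have h2 : u ≠ z := by
            rintro rfl; exact hn (by simpa using mem_or_mate_mem hμ hz)
          have h3 : μ u ≠ z := by
            rintro rfl
            have := mem_or_mate_mem hμ hz
            rw [hμ.invol] at this
            exact hn (by simpa using this.symm)
          simp [hit, h2, h3]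
        omega
      · have : hit μ u z ≤ 1 := by
          simp only [hit]
          split_ifs with h1 h2
          · exact absurd (h1.trans h2.symm) (hμ.adj u).ne
          all_goals omega
        omega

/-- An alternating walk arriving at `y` can be continued backwards along a walk ending in `y`. -/
theorem NN.back {w x y : V} {t s : List V} (hμ : IsMate G μ) (h : NN G μ w t y)
    (hs : NM G μ x s y) :
    ∃ t', NN G μ w t' x ∧ (∀ z, cov μ t' z = cov μ t z + cov μ s z) ∧
      t'.length = t.length + s.length := by
  rcases hs.last with ⟨rfl, rfl⟩ | ⟨m, rfl, hm⟩
  · exact ⟨t, h, by simp [cov_nil], by simp⟩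
  · refine ⟨t ++ μ y :: JposyGraphs.inv μ m, h.glue (hμ.invol y).symm (hm.inv hμ), fun z => ?_, ?_⟩
    · simp only [cov_append, cov_cons, cov_nil, hit_mate hμ, cov_inv hμ]; omega
    · simp [JposyGraphs.inv]

/-- An alternating walk arriving at the partner of `a` can be continued along a walk starting with
`a`. -/
theorem NN.forth {w a k : V} {t s : List V} (h : NN G μ w t (μ a)) (hs : NM G μ a s k) :
    ∃ t', NN G μ w t' (μ k) ∧
      (∀ z, hit μ k z + cov μ t' z = hit μ a z + cov μ s z + cov μ t z) := by
  rcases hs.last with ⟨rfl, rfl⟩ | ⟨m, rfl, hm⟩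
  · exact ⟨t, h, by simp [cov_nil]⟩
  · refine ⟨t ++ a :: m, h.glue rfl hm, fun z => ?_⟩
    simp only [cov_append, cov_cons, cov_nil]; omega

end Cover

end JposyGraphs

/-! ### Exchange along an alternating cycle -/

namespace JposyGraphs

variable {V : Type*} {G : SimpleGraph V} {μ : V → V}

theorem NN.isChain {a b : V} {t : List V} (hμ : IsMate G μ) (h : NN G μ a t b) :
    List.IsChain (fun u w => G.Adj u (μ w)) (a :: (t ++ [μ b])) := by
  induction t generalizing a with
  | nil =>
    have h' : G.Adj a b := h
    simpa [hμ.invol] using h'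
  | cons u t ih => exact List.IsChain.cons_cons h.1 (ih h.2)

theorem nm_reverse {μ' : V → V} (hμ : IsMate G μ) {a : V} {m : List V}
    (h : List.IsChain (fun z z' => μ' z = μ z') (a :: m)) :
    ∃ g m', (a :: m).reverse = g :: m' ∧ NM G μ' g m' a := by
  induction m generalizing a with
  | nil => exact ⟨a, [], rfl, rfl⟩
  | cons u m ih =>
    rw [List.isChain_cons_cons] at h
    obtain ⟨g, m', h1, h2⟩ := ih h.2
    refine ⟨g, m' ++ [a], by rw [List.reverse_cons, h1]; rfl, h2.append ⟨?_, rfl⟩⟩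
    rw [h.1]; exact hμ.adj u

theorem nn_reverse {μ' : V → V} (hμ : IsMate G μ) {a g : V} {n : List V}
    (h : List.IsChain (fun z z' => μ' z = μ z') (g :: (n ++ [a]))) :
    NN G μ' a n.reverse (μ' g) := by
  induction n generalizing g with
  | nil =>
    simp only [List.nil_append, List.isChain_cons_cons] at h
    change G.Adj a (μ' g)
    rw [h.1]; exact hμ.adj a
  | cons u n ih =>
    rw [List.cons_append, List.isChain_cons_cons] at h
    rw [List.reverse_cons]
    refine (ih h.2).glue rfl ?_
    change G.Adj u (μ' g)
    rw [h.1]; exact hμ.adj u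

theorem exists_next_of_isChain {R : V → V → Prop} {l : List V} {a z : V}
    (h : List.IsChain R (l ++ [a])) (hz : z ∈ l) : ∃ z' ∈ l ++ [a], R z z' := by
  obtain ⟨s, t, rfl⟩ := List.append_of_mem hz
  cases t with
  | nil =>
    refine ⟨a, by simp, ?_⟩
    have := (List.isChain_append.1 h).2.2
    simpa using this
  | cons u t =>
    refine ⟨u, by simp, ?_⟩
    rw [List.append_assoc, List.isChain_append] at h
    have := h.2.1
    simp only [List.cons_append, List.isChain_cons_cons] at this
    exact this.1

variable [DecidableEq V]

theorem isChain_formPerm {a : V} {L : List V} (h : (a :: L).Nodup) :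
    List.IsChain (fun z z' => (a :: L).formPerm z = z') (a :: L ++ [a]) := by
  rw [List.isChain_iff_getElem]
  intro i hi
  have hi' : i < (a :: L).length := by simpa using hi
  rw [List.getElem_append_left hi', List.formPerm_apply_getElem _ h i hi']
  by_cases h2 : i + 1 < (a :: L).length
  · rw [List.getElem_append_left h2]; simp only [Nat.mod_eq_of_lt h2]
  · have h3 : i + 1 = (a :: L).length := by omega
    rw [List.getElem_append_right (by omega)]
    simp [h3]

/-- Exchanging matching and non-matching edges along an alternating cycle. -/
theorem exists_switch (hμ : IsMate G μ) {a : V} {m n : List V}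
    (h : NN G μ a (m ++ n) (μ a)) (hs : Simple μ (a :: (m ++ n))) :
    ∃ μ', IsMate G μ' ∧ (∀ z, cov μ (a :: (m ++ n)) z = 0 → μ' z = μ z) ∧
      (∀ z, cov μ' (a :: (m ++ n)) z = cov μ (a :: (m ++ n)) z) ∧
      (∀ P z z' Q, a :: (m ++ n) ++ [a] = P ++ z :: z' :: Q → μ' (μ z') = z) ∧
      ∃ g m', (a :: m).reverse = g :: m' ∧ NM G μ' g m' a ∧ NN G μ' a n.reverse (μ' g) := by
  have hch := h.isChain hμ
  rw [hμ.invol] at hch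
  generalize hc : a :: (m ++ n) = c at *
  have hcL : c ++ [a] = a :: (m ++ n ++ [a]) := by rw [← hc]; simp
  have hca : a ∈ c := by simp [← hc]
  set σ := c.formPerm with hσ
  have hσc : List.IsChain (fun z z' => σ z = z') (c ++ [a]) := by
    rw [hσ, ← hc]; exact isChain_formPerm (hc ▸ hs.nodup)
  rw [← hcL] at hch
  have hmem : ∀ z, σ z ∈ c ↔ z ∈ c := fun z => List.formPerm_mem_iff_mem
  have hfix : ∀ z, z ∉ c → σ z = z := fun z hz => List.formPerm_apply_of_notMem hz
  have hnot : ∀ z ∈ c, μ z ∉ c := fun z hz => hs.mate_notMem hμ hz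
  have hadj : ∀ z ∈ c, G.Adj z (μ (σ z)) := by
    intro z hz
    have : List.IsChain (fun z z' => G.Adj z (μ z') ∧ σ z = z') (c ++ [a]) := by
      rw [List.isChain_iff_getElem] at *
      exact fun i hi => ⟨hch i hi, hσc i hi⟩
    obtain ⟨z', -, h1, rfl⟩ := exists_next_of_isChain this hz
    exact h1
  -- `σ` moves each black vertex to the next one on the cycle. The edge leaving a black `z` ends at
  -- the white vertex `μ (σ z)`, so these edges are the other matching of the cycle. Off the cycle
  -- `σ` is the identity and `μ'` agrees with `μ`.
  let μ' : V → V := fun z => if z ∈ c then μ (σ z) else σ⁻¹ (μ z)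
  have hin : ∀ z ∈ c, μ' z = μ (σ z) := fun z hz => if_pos hz
  have hout : ∀ z, z ∉ c → μ' z = σ⁻¹ (μ z) := fun z hz => if_neg hz
  have hσi : ∀ z, σ (σ⁻¹ z) = z := fun z => by simp
  have hiσ : ∀ z, σ⁻¹ (σ z) = z := fun z => by simp
  have hmem' : ∀ z, σ⁻¹ z ∈ c ↔ z ∈ c := fun z => by
    rw [← hmem (σ⁻¹ z), hσi]
  have hfix' : ∀ z, z ∉ c → σ⁻¹ z = z := fun z hz => by
    rw [Equiv.Perm.inv_eq_iff_eq]; exact (hfix z hz).symm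
  have hback : ∀ z ∈ c, μ' (μ (σ z)) = z := fun z hz => by
    rw [hout _ (hnot _ ((hmem z).2 hz)), hμ.invol, hiσ]
  have hμ'chain : List.IsChain (fun z z' => μ' z = μ z' ∧ μ' (μ z') = z) (c ++ [a]) := by
    rw [List.isChain_iff_getElem] at *
    intro i hi
    have h1 : (c ++ [a])[i] ∈ c := by
      rw [List.getElem_append_left (by simpa using hi)]; exact List.getElem_mem _
    rw [← hσc i hi]
    exact ⟨hin _ h1, hback _ h1⟩
  refine ⟨μ', ⟨fun z => ?_, fun z => ?_⟩, fun z hz => ?_, fun z => ?_, ?_, ?_⟩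
  · by_cases hz : z ∈ c
    · rw [hin z hz, hback z hz]
    · by_cases hz' : μ z ∈ c
      · rw [hout z hz, hin _ ((hmem' _).2 hz'), hσi, hμ.invol]
      · rw [hout z hz, hfix' _ hz', hout _ hz', hμ.invol, hfix' z hz]
  · by_cases hz : z ∈ c
    · rw [hin z hz]; exact hadj z hz
    · rw [hout z hz]
      by_cases hz' : μ z ∈ c
      · have := hadj _ ((hmem' _).2 hz')
        rw [hσi, hμ.invol] at this
        exact this.symm
      · rw [hfix' _ hz']; exact hμ.adj z
  · have h1 : z ∉ c := fun h => by have := cov_pos_of_mem (μ := μ) h; omega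
    have h2 : μ z ∉ c := fun h => by have := cov_pos_of_mate_mem hμ h; omega
    rw [hout z h1, hfix' _ h2]
  · rw [cov_eq_count, cov_eq_count]
    congr 1
    have h1 : c.map μ' = (c.map σ).map μ := by
      rw [List.map_map]; exact List.map_congr_left fun z hz => hin z hz
    have h2 : (c.map σ).Perm c := by
      refine (List.perm_ext_iff_of_nodup (hs.nodup.map σ.injective) hs.nodup).2 fun z => ?_
      simp only [List.mem_map]
      exact ⟨fun ⟨w, hw, e⟩ => e ▸ (hmem w).2 hw,
        fun hz => ⟨σ⁻¹ z, (hmem' z).2 hz, hσi z⟩⟩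
    rw [h1]
    exact (h2.map μ).count_eq z
  · intro P z z' Q he
    rw [he] at hμ'chain
    have := (List.isChain_append.1 hμ'chain).2.1
    rw [List.isChain_cons_cons] at this
    exact this.1.2
  · have hch' : List.IsChain (fun z z' => μ' z = μ z') (c ++ [a]) :=
      hμ'chain.imp fun _ _ h => h.1
    have e1 : c ++ [a] = (a :: m) ++ (n ++ [a]) := by rw [← hc]; simp
    obtain ⟨g, m', h1, h2⟩ := nm_reverse hμ (List.isChain_append.1 (e1 ▸ hch')).1
    refine ⟨g, m', h1, h2, nn_reverse hμ ?_⟩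
    have h3 : a :: m = m'.reverse ++ [g] := by
      rw [← List.reverse_reverse (a :: m), h1, List.reverse_cons]
    rw [e1, h3, List.append_assoc] at hch'
    simpa using (List.isChain_append.1 hch').2.1

end JposyGraphs

/-! ### Choosing an arc through `v` -/

namespace JposyGraphs

variable {V : Type*} {G : SimpleGraph V} {μ : V → V}

theorem NN.rotate {a h : V} {L : List V} (hc : NN G μ a L (μ a)) (hh : h ∈ a :: L) :
    ∃ L', NN G μ h L' (μ h) ∧ (h :: L').Perm (a :: L) := by
  obtain ⟨l, q, rfl, h1, h2⟩ := hc.split_mem hh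
  rcases h1.last with ⟨rfl, rfl⟩ | ⟨m, rfl, hm⟩
  · exact ⟨q, h2, List.Perm.refl _⟩
  · refine ⟨q ++ a :: m, h2.glue rfl hm, ?_⟩
    have : (h :: q ++ a :: m).Perm (a :: m ++ h :: q) := List.perm_append_comm
    simpa using this

variable [DecidableEq V]

theorem cov_perm {l l' : List V} (h : l.Perm l') (z : V) : cov μ l z = cov μ l' z := by
  rw [cov_eq_count, cov_eq_count, h.count_eq, (h.map μ).count_eq]

/-- Exchange along an alternating cycle, followed by a traversal of one of its arcs. -/
theorem exists_switch_cover (hμ : IsMate G μ) {a k : V} {m n : List V}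
    (h : NN G μ a (m ++ n) (μ a)) (hs : Simple μ (a :: (m ++ n)))
    (hk : (n ++ [a]).head? = some k) :
    ∃ μ', IsMate G μ' ∧ (∀ z, cov μ (a :: (m ++ n)) z = 0 → μ' z = μ z) ∧
      (∀ P z z' Q, a :: (m ++ n) ++ [a] = P ++ z :: z' :: Q → μ' (μ z') = z) ∧
      ∃ g m', NM G μ' g m' a ∧ NN G μ' a n.reverse (μ' g) ∧ μ' g = μ k ∧
        (g :: (m' ++ n.reverse)).Perm (a :: (m ++ n)) ∧
        (∀ z, cov μ' (g :: (m' ++ n.reverse)) z = cov μ (a :: (m ++ n)) z) ∧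
        ∀ v, 1 ≤ cov μ m v → 1 ≤ cov μ' (g :: m') v := by
  obtain ⟨μ', hμ', h1, h2, h3, g, m', h4, h5, h6⟩ := exists_switch hμ h hs
  have hp : (g :: (m' ++ n.reverse)).Perm (a :: (m ++ n)) := by
    have e : g :: (m' ++ n.reverse) = (a :: m).reverse ++ n.reverse := by rw [h4]; rfl
    rw [e]
    exact (List.reverse_perm _).append (List.reverse_perm _)
  have e2 : a :: m = m'.reverse ++ [g] := by
    rw [← List.reverse_reverse (a :: m), h4, List.reverse_cons]
  refine ⟨μ', hμ', h1, h3, g, m', h5, h6, ?_, hp, fun z => (cov_perm hp z).trans (h2 z),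
    fun v hv => ?_⟩
  · obtain ⟨Q, hQ⟩ : ∃ Q, n ++ [a] = k :: Q := by
      cases hn : n ++ [a] with
      | nil => simp at hn
      | cons b Q => rw [hn] at hk; simp at hk; exact ⟨Q, by rw [hk]⟩
    have : μ' (μ k) = g := by
      apply h3 m'.reverse g k Q
      calc a :: (m ++ n) ++ [a] = (a :: m) ++ (n ++ [a]) := by simp
        _ = _ := by rw [e2, hQ]; simp
    rw [← this, hμ'.invol]
  · have hmem : ∀ z, z ∈ a :: m → z ∈ g :: m' := fun z hz => by
      rw [← h4]; exact List.mem_reverse.2 hz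
    rcases mem_or_mate_mem hμ hv with h | h
    · exact cov_pos_of_mem (hmem _ (by simp [h]))
    · obtain ⟨q1, q2, rfl⟩ := List.append_of_mem h
      obtain ⟨P, z, hz⟩ : ∃ P z, a :: q1 = P ++ [z] :=
        ⟨_, _, (List.dropLast_append_getLast (List.cons_ne_nil a q1)).symm⟩
      have h7 : μ' (μ (μ v)) = z := by
        apply h3 P z (μ v) (q2 ++ n ++ [a])
        calc a :: (q1 ++ μ v :: q2 ++ n) ++ [a] = (a :: q1) ++ (μ v :: (q2 ++ n ++ [a])) := by simp
          _ = _ := by rw [hz]; simp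
      rw [hμ.invol] at h7
      refine cov_pos_of_mate_mem hμ' (hmem _ ?_)
      rw [h7]
      have : z ∈ a :: q1 := by rw [hz]; simp
      simp only [List.mem_cons, List.mem_append] at this ⊢
      tauto

/-- Given a black vertex `x`, a white vertex `x'` and a vertex `v` of an alternating cycle, one of
the two matchings of the cycle has an alternating path on it from `x'` to `x` through `v`. -/
theorem exists_orient (hμ : IsMate G μ) {a x x' v : V} {L : List V}
    (hc : NN G μ a L (μ a)) (hs : Simple μ (a :: L)) (hx : x ∈ a :: L) (hx' : μ x' ∈ a :: L)
    (hv : 1 ≤ cov μ (a :: L) v) :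
    ∃ μ', IsMate G μ' ∧ (∀ z, cov μ (a :: L) z = 0 → μ' z = μ z) ∧
      ∃ h l q, NM G μ' h l x ∧ NN G μ' x q (μ' h) ∧ x' = μ' h ∧
        (h :: (l ++ q)).Perm (a :: L) ∧
        (∀ z, cov μ' (h :: (l ++ q)) z = cov μ (a :: L) z) ∧ 1 ≤ cov μ' (h :: l) v := by
  obtain ⟨L', hc', hp⟩ := hc.rotate hx'
  set h := μ x' with hh
  have hx'h : x' = μ h := (hμ.invol x').symm
  obtain ⟨l, q, rfl, h1, h2⟩ := hc'.split_mem (hp.mem_iff.2 hx)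
  by_cases hvl : 1 ≤ cov μ (h :: l) v
  · exact ⟨μ, hμ, fun _ _ => rfl, h, l, q, h1, h2, hx'h, hp, cov_perm hp, hvl⟩
  have hvq : 1 ≤ cov μ q v := by
    rw [← cov_perm hp, ← List.cons_append, cov_append] at hv; omega
  -- Now `v` is on the complementary arc `q`, whose end edges are outside the matching. Rewriting
  -- the cycle from `x` with `q` first lets the exchange turn this arc into the required path.
  obtain ⟨n, hn, hnp, hk⟩ : ∃ n, NN G μ x (q ++ n) (μ x) ∧ (x :: (q ++ n)).Perm (h :: (l ++ q)) ∧
      (n ++ [x]).head? = some h := by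
    rcases h1.last with ⟨rfl, rfl⟩ | ⟨m, rfl, hm⟩
    · exact ⟨[], by simpa using h2, by simp, rfl⟩
    · refine ⟨h :: m, h2.glue rfl hm, ?_, rfl⟩
      have : (x :: q ++ h :: m).Perm (h :: m ++ x :: q) := List.perm_append_comm
      simpa using this
  have hs' : Simple μ (x :: (q ++ n)) := fun z => by rw [cov_perm (hnp.trans hp)]; exact hs z
  obtain ⟨μ', hμ', e1, -, g, m', e2, e3, e4, e5, e6, e7⟩ := exists_switch_cover hμ hn hs' hk
  refine ⟨μ', hμ', fun z hz => e1 z (by rwa [cov_perm (hnp.trans hp)]), g, m', n.reverse, e2, e3,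
    ?_, e5.trans (hnp.trans hp), fun z => (e6 z).trans (cov_perm (hnp.trans hp) z), e7 v hvq⟩
  rw [hx'h, e4]

/-! ### Target configuration, flowers and exits -/

/-- Two blossoms, `w` at `x` and `z` at the partner of `h`, joined by an alternating path, for some
perfect matching; the vertex `v` is on one of the three. -/
def HasTposy (G : SimpleGraph V) (v : V) : Prop :=
  ∃ μ, IsMate G μ ∧ ∃ h l x w z, NM G μ h l x ∧ NN G μ x w x ∧ NN G μ (μ h) z (μ h) ∧
    Simple μ (h :: l ++ w) ∧ Simple μ (h :: l ++ z) ∧ 1 ≤ cov μ (h :: l ++ w ++ z) v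

/-- A path with a flower at each end contains the data of `HasTposy`. -/
theorem HasTposy.of_flowers (hμ : IsMate G μ) {h x b b' v : V} {l s w s' w' : List V}
    (hl : NM G μ h l x) (hs : NM G μ x s b) (hw : NN G μ b w b)
    (hs' : NM G μ (μ h) s' b') (hw' : NN G μ b' w' b')
    (h1 : Simple μ (h :: l ++ s ++ s' ++ w)) (h2 : Simple μ (h :: l ++ s ++ s' ++ w'))
    (hv : 1 ≤ cov μ (h :: l ++ s ++ s' ++ w ++ w') v) : HasTposy G v := by
  obtain ⟨r, hr, hc⟩ := hs'.inv hμ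
  rw [hμ.invol] at hr
  have hc' : ∀ z, hit μ (μ b') z + cov μ r z = hit μ h z + cov μ s' z := fun z => by
    have := congrArg (fun l => cov μ l z) hc
    simpa only [cov_inv hμ, cov_cons, hit_mate hμ] using this
  refine ⟨μ, hμ, μ b', r ++ (l ++ s), b, w, w', hr.append (hl.append hs), hw, ?_,
    fun z => ?_, fun z => ?_, ?_⟩
  · rwa [hμ.invol]
  · have := h1 z; have := hc' z
    simp only [cov_append, cov_cons] at *; omega
  · have := h2 z; have := hc' z
    simp only [cov_append, cov_cons] at *; omega
  · have := hc' v
    simp only [cov_append, cov_cons] at *; omega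

/-- An alternating walk leaving the vertices `c` for ever, or until it returns to a vertex in `c`,
or until it closes a blossom. -/
structure Exit (G : SimpleGraph V) (μ : V → V) (c : List V) (x : V) (t : List V) (y : V) :
    Prop where
  mem : x ∈ c
  walk : NN G μ x t y
  closing : y ∈ c ∨ y ∈ t
  simple : Simple μ (c ++ t)

/-- Cut the walk where it first meets `c`. Arriving at a vertex of `c` closes an ear; arriving at
the partner of one forces the crossing into `c`, from where the walk starts afresh. -/
theorem Exit.exists_of_walk (hμ : IsMate G μ) {c : List V} (hc : Simple μ c) {x y : V} {t : List V}
    (hx : x ∈ c) (ht : NN G μ x t y) (hy : y ∈ c ∨ y ∈ t) (hs : Simple μ t) :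
    ∃ x' t' y', Exit G μ c x' t' y' ∧ t'.length ≤ t.length := by
  induction hn : t.length using Nat.strong_induction_on generalizing x t y with
  | _ n ih =>
  by_cases h : Simple μ (c ++ t)
  · exact ⟨x, t, y, ⟨hx, ht, hy, h⟩, hn.le⟩
  obtain ⟨A, z, B, rfl, h1, h2⟩ := exists_first_hit hc h hμ
  have hzA : ¬ (z ∈ A ∨ μ z ∈ A) := fun h => by
    have h3 : 1 ≤ cov μ A z := h.elim cov_pos_of_mem (cov_pos_of_mate_mem hμ)
    have := hs z
    have := hit_self (μ := μ) z
    simp only [cov_append, cov_cons] at *; omega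
  obtain ⟨hA, hB⟩ := ht.split_cons
  simp only [List.length_append, List.length_cons] at hn
  simp only [List.mem_append] at h2
  by_cases hz : μ z ∈ c
  · exact ⟨x, A, μ z, ⟨hx, hA, Or.inl hz, h1⟩, by omega⟩
  have hz' : z ∈ c := by tauto
  have hsB : Simple μ B := fun w => by
    have := hs w
    simp only [cov_append, cov_cons] at *; omega
  by_cases hyB : y ∈ c ∨ y ∈ B
  · obtain ⟨x', t', y', e1, e2⟩ := ih B.length (by omega) hz' hB hyB hsB rfl
    exact ⟨x', t', y', e1, by omega⟩
  -- The remainder ends on the discarded piece `A`. There it crosses the matching edge of `y` and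
  -- follows `A` back to `x`, which lies in `c`.
  have hyA : y ∈ A := by
    have : y ≠ z := fun e => hyB (Or.inl (e ▸ hz'))
    simp only [List.mem_append, List.mem_cons] at hy
    tauto
  obtain ⟨A1, A2, rfl⟩ := List.append_of_mem hyA
  have hback := hB.glue (u := μ y) (hμ.invol y).symm (hA.split_cons.1.inv hμ)
  obtain ⟨x', t', y', e1, e2⟩ := ih _ (by simp [inv] at hn ⊢; omega) hz' hback (Or.inl hx)
    (fun w => by
      have := hs w
      simp only [cov_append, cov_cons, cov_inv hμ, hit_mate hμ] at *; omega) rfl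
  refine ⟨x', t', y', e1, ?_⟩
  simp [inv] at hn e2 ⊢; omega

/-- At the first repeated matching edge, a repetition in the same direction is a detour that can be
cut out, while one in the opposite direction means that the walk has already closed on itself. -/
theorem exists_simple_walk (hμ : IsMate G μ) {x y : V} {t : List V} (ht : NN G μ x t y) :
    ∃ t' y', NN G μ x t' y' ∧ Simple μ t' ∧ (y' = y ∨ y' ∈ t') := by
  induction hn : t.length using Nat.strong_induction_on generalizing t with
  | _ n ih =>
  by_cases h : Simple μ ([] ++ t)
  · exact ⟨t, y, ht, h, Or.inl rfl⟩
  obtain ⟨A, z, B, rfl, h1, h2⟩ := exists_first_hit (fun z => by simp [cov_nil]) h hμ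
  obtain ⟨hA, hB⟩ := ht.split_cons
  simp only [List.nil_append] at h1 h2
  rcases h2 with h2 | h2
  · obtain ⟨A1, A2, rfl⟩ := List.append_of_mem h2
    exact ih _ (by simp at hn ⊢; omega) (hA.split_cons.1.glue rfl hB) rfl
  · exact ⟨A, μ z, hA, h1, Or.inr h2⟩

end JposyGraphs

/-! ### Tposies from disjoint exits, and from ears ending off the chosen arc -/

namespace JposyGraphs

variable {V : Type*} {G : SimpleGraph V} {μ : V → V} [DecidableEq V]

theorem hit_le_cov {l : List V} {a : V} (h : a ∈ l) (z : V) : hit μ a z ≤ cov μ l z := by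
  obtain ⟨l1, l2, rfl⟩ := List.append_of_mem h
  simp only [cov_append, cov_cons]; omega

theorem Simple.cov_eq_zero {c t : List V} (h : Simple μ (c ++ t)) {z : V} (hz : z ∈ t) :
    cov μ c z = 0 := by
  have h1 := h z
  have := cov_pos_of_mem (μ := μ) hz
  rw [cov_append] at h1; omega

/-- An exit walk together with a walk `q` closing the cycle yields a flower. -/
theorem exists_flower (hμ : IsMate G μ) {x y e : V} {t q : List V} (ht : NN G μ x t y)
    (hq : NN G μ x q e) (hy : y ∈ x :: t ∨ y ∈ q) :
    ∃ s w b, NM G μ x s b ∧ NN G μ b w b ∧ (∀ z, cov μ s z ≤ cov μ t z) ∧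
      ∀ z, cov μ s z + cov μ w z ≤ cov μ t z + cov μ q z := by
  rcases hy with hy | hy
  · obtain ⟨s, w, rfl, h1, h2⟩ := ht.split_mem hy
    refine ⟨s, w, y, h1, h2, fun z => ?_, fun z => ?_⟩ <;> rw [cov_append] <;> omega
  · obtain ⟨s, r, rfl, h1, -⟩ := hq.split_mem (List.mem_cons_of_mem _ hy)
    obtain ⟨w, h2, h3, -⟩ := ht.back hμ h1
    refine ⟨[], w, x, rfl, h2, fun z => by simp [cov_nil], fun z => ?_⟩
    rw [h3, cov_nil, cov_append]; omega

/-- Exits on both sides ending outside the chosen arc of the cycle. -/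
theorem HasTposy.of_exits (hμ : IsMate G μ) {h x y y' v : V} {l q t t' : List V}
    (hl : NM G μ h l x) (hq : NN G μ x q (μ h)) (ht : NN G μ x t y) (ht' : NN G μ (μ h) t' y')
    (hy : y ∈ x :: t ∨ y ∈ q) (hy' : y' ∈ μ h :: t' ∨ μ y' ∈ q)
    (hs : Simple μ (h :: (l ++ q) ++ t ++ t')) (hv : 1 ≤ cov μ (h :: l) v) : HasTposy G v := by
  obtain ⟨s, w, b, h1, h2, h3, h4⟩ := exists_flower hμ ht hq hy
  obtain ⟨s', w', b', h1', h2', h3', h4'⟩ := exists_flower hμ ht' (hq.inv hμ)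
    (hy'.imp_right (mem_inv hμ).2)
  simp only [cov_inv hμ] at h4'
  refine HasTposy.of_flowers hμ hl h1 h2 h1' h2' (fun z => ?_) (fun z => ?_) ?_
  · have := hs z; have := h3' z; have := h4 z
    simp only [cov_append, cov_cons] at *; omega
  · have := hs z; have := h3 z; have := h4' z
    simp only [cov_append, cov_cons] at *; omega
  · simp only [cov_append, cov_cons] at *; omega

/-- Both exits are ears of the cycle ending outside the chosen arc. They may meet. -/
theorem HasTposy.of_ears (hμ : IsMate G μ) {h x y y' v : V} {l q t t' : List V}
    (hl : NM G μ h l x) (hq : NN G μ x q (μ h)) (ht : NN G μ x t y) (ht' : NN G μ (μ h) t' y')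
    (hy : y ∈ q) (hy' : μ y' ∈ q) (hs : Simple μ (h :: (l ++ q) ++ t))
    (hs' : Simple μ (h :: (l ++ q) ++ t')) (hv : 1 ≤ cov μ (h :: l) v) : HasTposy G v := by
  obtain ⟨s, r, e, h1, -⟩ := hq.split_mem (List.mem_cons_of_mem _ hy)
  obtain ⟨w, h2, h3, -⟩ := ht.back hμ h1
  obtain ⟨s', r', e', h1', -⟩ := (hq.inv hμ).split_mem
    (List.mem_cons_of_mem _ ((mem_inv hμ).2 hy'))
  obtain ⟨w', h2', h3', -⟩ := ht'.back hμ h1'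
  refine ⟨μ, hμ, h, l, x, w, w', hl, h2, h2', fun z => ?_, fun z => ?_, ?_⟩
  · have := hs z
    simp only [e, cov_append, cov_cons, h3] at *; omega
  · have := hs' z
    have e2 : cov μ q z = cov μ s' z + cov μ r' z := by rw [← cov_append, ← e', cov_inv hμ]
    simp only [cov_append, cov_cons, h3'] at *; omega
  · simp only [cov_append, cov_cons] at *; omega

/-- The black exit is an ear ending on the chosen arc. -/
theorem HasTposy.of_ear_exit (hμ : IsMate G μ) {h x y y' v : V} {l q t t' : List V}
    (hl : NM G μ h l x) (hq : NN G μ x q (μ h)) (ht : NN G μ x t y) (ht' : NN G μ (μ h) t' y')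
    (hy : y ∈ h :: l) (hy' : y' ∈ μ h :: t' ∨ μ y' ∈ q)
    (hs : Simple μ (h :: (l ++ q) ++ t ++ t')) (hv : 1 ≤ cov μ (h :: l) v) : HasTposy G v := by
  obtain ⟨l1, l2, rfl, hl1, hl2⟩ := hl.split_mem hy
  obtain ⟨w, hw, hwc, -⟩ := (ht.inv hμ).back hμ hl2
  simp only [cov_inv hμ] at hwc
  obtain ⟨s', w', b', h1', h2', h3', h4'⟩ := exists_flower hμ ht' (hq.inv hμ)
    (hy'.imp_right (mem_inv hμ).2)
  simp only [cov_inv hμ] at h4'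
  refine HasTposy.of_flowers hμ hl1 (s := []) rfl hw h1' h2' (fun z => ?_) (fun z => ?_) ?_
  · have := hs z; have := h3' z; have := h4' z
    simp only [cov_append, cov_cons, cov_nil, hwc] at *; omega
  · have := hs z; have := h4' z
    simp only [cov_append, cov_cons, cov_nil] at *; omega
  · simp only [cov_append, cov_cons, cov_nil, hwc] at *; omega

/-- Both exits are ears, their ends alternate on the cycle, and `v` is between the ends `y`, `k`. -/
theorem HasTposy.of_crossing_ears (hμ : IsMate G μ) {h x y k v : V} {l1 m l22 q t t' : List V}
    (hl1 : NM G μ h l1 y) (hm : NN G μ y m (μ k)) (hl22 : NM G μ k l22 x)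
    (hq : NN G μ x q (μ h)) (ht : NN G μ x t y) (ht' : NN G μ (μ h) t' (μ k))
    (hs : Simple μ (h :: (l1 ++ (m ++ [k] ++ l22) ++ q) ++ t ++ t')) (hvm : 1 ≤ cov μ m v) :
    HasTposy G v := by
  -- The cycle is rewritten from `y`, with `m` as first arc and `n` as the rest. After the exchange
  -- `m` carries the path, and the reversed ears leave its ends and finish on `n`.
  obtain ⟨n, Q, hn, hnc, hnQ, hnsub⟩ : ∃ n Q, NN G μ y (m ++ n) (μ y) ∧
      (∀ z, cov μ (y :: (m ++ n)) z = cov μ (h :: (l1 ++ (m ++ [k] ++ l22) ++ q)) z) ∧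
      n ++ [y] = k :: (l22 ++ q) ++ h :: Q ∧ ∀ z ∈ k :: (l22 ++ q), z ∈ n := by
    have h0 := hm.glue rfl (hl22.append_nn hq)
    rcases hl1.last with ⟨rfl, rfl⟩ | ⟨m1, rfl, hm1⟩
    · refine ⟨k :: (l22 ++ q), [], h0, fun z => ?_, rfl, fun z hz => hz⟩
      simp only [cov_append, cov_cons, cov_nil]; omega
    · refine ⟨k :: (l22 ++ q) ++ h :: m1, m1 ++ [y], ?_, fun z => ?_, by simp, fun z hz => ?_⟩
      · have := h0.glue rfl hm1
        simpa using this
      · simp only [cov_append, cov_cons, cov_nil]; omega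
      · exact List.mem_append_left _ hz
  have hsn : Simple μ (y :: (m ++ n)) := fun z => by
    have := hs z
    rw [hnc]; simp only [cov_append, cov_cons, cov_nil] at *; omega
  obtain ⟨μ', hμ', e1, e2, g, m', e3, e4, e5, -, e7, e8⟩ := exists_switch_cover hμ hn hsn (k := k)
    (by rw [hnQ]; rfl)
  have hoff : ∀ z, 1 ≤ cov μ t z + cov μ t' z → μ' z = μ z := fun z hz => e1 z (by
    have := hs z
    rw [hnc]; simp only [cov_append, cov_cons, cov_nil] at *; omega)
  have hti : ∀ z ∈ inv μ t, μ' z = μ z := fun z hz => hoff z (by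
    have := cov_pos_of_mem (μ := μ) hz
    rw [cov_inv hμ] at this; omega)
  have hti' : ∀ z ∈ inv μ t', μ' z = μ z := fun z hz => hoff z (by
    have := cov_pos_of_mem (μ := μ) hz
    rw [cov_inv hμ] at this; omega)
  have hwe : NN G μ' (μ' g) (inv μ t') (μ h) := by rw [e5]; exact (ht'.inv hμ).congr hti'
  refine HasTposy.of_exits hμ' e3 e4 ((ht.inv hμ).congr hti)
    hwe (Or.inr ?_) (Or.inr ?_) (fun z => ?_) (e8 v hvm)
  · refine List.mem_reverse.2 (hnsub x ?_)
    have := hl22.mem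
    simp only [List.mem_cons, List.mem_append] at *; tauto
  -- `p` is the black vertex just before `h` on the cycle, hence the new partner of `μ h`.
  · obtain ⟨P, p, hp⟩ : ∃ P p, k :: (l22 ++ q) = P ++ [p] :=
      ⟨_, _, (List.dropLast_append_getLast (List.cons_ne_nil k (l22 ++ q))).symm⟩
    have : μ' (μ h) = p := by
      apply e2 (y :: m ++ P) p h Q
      calc y :: (m ++ n) ++ [y] = y :: m ++ (n ++ [y]) := by simp
        _ = _ := by rw [hnQ, hp]; simp
    rw [this]
    exact List.mem_reverse.2 (hnsub p (by rw [hp]; simp))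
  · have h1 := hs z
    have h2 := e7 z
    rw [hnc] at h2
    rw [cov_append, cov_append, h2, cov_congr hti, cov_congr hti', cov_inv hμ, cov_inv hμ]
    simp only [cov_append, cov_cons, cov_nil] at *; omega

/-- Both exits are ears ending on the chosen arc. -/
theorem HasTposy.of_inner_ears (hμ : IsMate G μ) {h x y k v : V} {l q t t' : List V}
    (hl : NM G μ h l x) (hq : NN G μ x q (μ h)) (ht : NN G μ x t y)
    (ht' : NN G μ (μ h) t' (μ k)) (hy : y ∈ h :: l) (hk : k ∈ h :: l)
    (hs : Simple μ (h :: (l ++ q) ++ t ++ t')) (hv : 1 ≤ cov μ (h :: l) v) : HasTposy G v := by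
  obtain ⟨l1, l2, rfl, hl1, hl2⟩ := hl.split_mem hy
  obtain ⟨w, hw, hwc, -⟩ := (ht.inv hμ).back hμ hl2
  simp only [cov_inv hμ] at hwc
  by_cases hk1 : k ∈ h :: l1
  -- The ends occur in the order `k`, `y` on the arc. The piece between them is the path, and each
  -- ear closes a blossom with the outer piece on its side.
  · obtain ⟨l11, l12, rfl, hl11, hl12⟩ := hl1.split_mem hk1
    obtain ⟨z, hz, hzc⟩ := (ht'.inv hμ).forth hl11
    simp only [cov_inv hμ] at hzc
    have hkc := fun z => hit_le_cov (μ := μ) hl11.mem z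
    refine ⟨μ, hμ, k, l12, y, w, z, hl12, hw, hz, fun z => ?_, fun z => ?_, ?_⟩
    · have := hs z; have := hkc z
      simp only [cov_append, cov_cons, hwc] at *; omega
    · have := hs z; have := hzc z
      simp only [cov_append, cov_cons] at *; omega
    · have := hzc v
      simp only [cov_append, cov_cons, hwc] at *; omega
  have hk2 : k ∈ l2 := by simp at hk hk1; tauto
  obtain ⟨l21, l22, rfl, hl21, hl22⟩ := hl2.split_mem (List.mem_cons_of_mem _ hk2)
  rcases hl21.last with ⟨rfl, rfl⟩ | ⟨m, rfl, hm⟩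
  · exact absurd hl1.mem hk1
  -- Here `y` precedes `k`, and the ends cut the arc into three pieces. If `v` is on an outer piece,
  -- that piece is the path, and the ears with the rest of the cycle supply overlapping blossoms.
  -- Only the middle piece needs an exchange.
  by_cases hv1 : 1 ≤ cov μ (h :: l1) v
  · refine ⟨μ, hμ, h, l1, y, w, t' ++ k :: (l22 ++ q), hl1, hw, ht'.glue rfl (hl22.append_nn hq),
      fun z => ?_, fun z => ?_, ?_⟩
    · have := hs z
      simp only [cov_append, cov_cons, cov_nil, hwc] at *; omega
    · have := hs z
      simp only [cov_append, cov_cons, cov_nil] at *; omega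
    · simp only [cov_append, cov_cons] at *; omega
  by_cases hv2 : 1 ≤ cov μ (k :: l22) v
  · refine ⟨μ, hμ, k, l22, x, q ++ h :: (l1 ++ inv μ t), inv μ t' ++ h :: (l1 ++ m), hl22,
      hq.glue rfl (hl1.append_nn (ht.inv hμ)), (ht'.inv hμ).glue rfl (hl1.append_nn hm),
      fun z => ?_, fun z => ?_, ?_⟩
    · have := hs z
      simp only [cov_append, cov_cons, cov_nil, cov_inv hμ] at *; omega
    · have := hs z
      simp only [cov_append, cov_cons, cov_nil, cov_inv hμ] at *; omega
    · simp only [cov_append, cov_cons] at *; omega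
  have hvm : 1 ≤ cov μ m v := by simp only [cov_append, cov_cons, cov_nil] at *; omega
  exact HasTposy.of_crossing_ears hμ hl1 hm hl22 hq ht ht' hs hvm

/-- Disjoint exits of an alternating cycle, one from a black and one from a white vertex. -/
theorem HasTposy.of_disjoint (hμ : IsMate G μ) {h x y y' v : V} {l q t t' : List V}
    (hl : NM G μ h l x) (hq : NN G μ x q (μ h)) (ht : NN G μ x t y) (ht' : NN G μ (μ h) t' y')
    (hy : y ∈ h :: (l ++ q) ∨ y ∈ t) (hy' : μ y' ∈ h :: (l ++ q) ∨ y' ∈ t')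
    (hs : Simple μ (h :: (l ++ q) ++ t ++ t')) (hv : 1 ≤ cov μ (h :: l) v) : HasTposy G v := by
  by_cases hyl : y ∈ h :: l
  · by_cases hyl' : μ y' ∈ h :: l
    · exact HasTposy.of_inner_ears hμ hl hq ht (by rwa [hμ.invol]) hyl hyl' hs hv
    · refine HasTposy.of_ear_exit hμ hl hq ht ht' hyl ?_ hs hv
      simp only [List.mem_cons, List.mem_append] at *; tauto
  have hyr : y ∈ x :: t ∨ y ∈ q := by
    simp only [List.mem_cons, List.mem_append] at *; tauto
  by_cases hyl' : μ y' ∈ h :: l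
  -- Traversing the path backwards interchanges the two exits.
  · obtain ⟨r, hr, hrc⟩ := hl.inv hμ
    have hc : ∀ z, cov μ (μ x :: r) z = cov μ (h :: l) z := fun z => by rw [hrc, cov_inv hμ]
    refine HasTposy.of_ear_exit hμ hr (q := inv μ q) (by rw [hμ.invol]; exact hq.inv hμ) ht'
      (by rwa [hμ.invol]) ?_ ?_ (fun z => ?_) (by rwa [hc])
    · rw [hrc]; exact (mem_inv hμ).2 hyl'
    · rw [hμ.invol, mem_inv hμ, hμ.invol]; exact hyr
    · have := hs z; have := hc z
      simp only [cov_append, cov_cons, cov_inv hμ] at *; omega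
  · refine HasTposy.of_exits hμ hl hq ht ht' hyr ?_ hs hv
    by_cases e : y' = μ h
    · simp [e]
    · simp only [List.mem_cons, List.mem_append] at *; tauto

end JposyGraphs

/-! ### Induction for exits that meet -/

namespace JposyGraphs

variable {V : Type*} {G : SimpleGraph V} {μ : V → V} [DecidableEq V]

/-- Exits of an alternating cycle stay exits after one of its two matchings has been chosen. -/
theorem exists_orient_exits (hμ : IsMate G μ) {a x y x' y' v : V} {L t t' : List V}
    (hc : NN G μ a L (μ a)) (he : Exit G μ (a :: L) x t y)
    (he' : Exit G μ ((a :: L).map μ) x' t' y') (hv : 1 ≤ cov μ (a :: L) v) :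
    ∃ μ', IsMate G μ' ∧ (∀ z, z ∈ t ∨ z ∈ t' → μ' z = μ z) ∧
      ∃ h l q, NM G μ' h l x ∧ NN G μ' x q (μ' h) ∧ NN G μ' x t y ∧ NN G μ' (μ' h) t' y' ∧
        (y ∈ h :: (l ++ q) ∨ y ∈ t) ∧ (μ' y' ∈ h :: (l ++ q) ∨ y' ∈ t') ∧
        (∀ z, cov μ' (h :: (l ++ q)) z = cov μ (a :: L) z) ∧
        l.length + q.length = L.length ∧ 1 ≤ cov μ' (h :: l) v := by
  have hs : Simple μ (a :: L) := fun z => by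
    have := he.simple z
    rw [cov_append] at this; omega
  have hmap : ∀ z, z ∈ (a :: L).map μ → μ z ∈ a :: L := fun z hz => by
    obtain ⟨w, hw, rfl⟩ := List.mem_map.1 hz
    rwa [hμ.invol]
  obtain ⟨μ', hμ', h1, h, l, q, h2, h3, h4, h5, h6, h7⟩ :=
    exists_orient hμ hc hs he.mem (hmap _ he'.mem) hv
  have hst : ∀ z ∈ t, μ' z = μ z := fun z hz => h1 z (he.simple.cov_eq_zero hz)
  have hst' : ∀ z ∈ t', μ' z = μ z := fun z hz => h1 z (by
    rw [← cov_map hμ]; exact he'.simple.cov_eq_zero hz)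
  refine ⟨μ', hμ', fun z hz => hz.elim (hst z) (hst' z), h, l, q, h2, h3, he.walk.congr hst,
    h4 ▸ he'.walk.congr hst', he.closing.imp_left h5.mem_iff.2, ?_, h6, ?_, h7⟩
  · refine he'.closing.imp_left fun hy => ?_
    have h8 : 1 ≤ cov μ' (h :: (l ++ q)) y' := by
      rw [h6]; exact cov_pos_of_mate_mem hμ (hmap _ hy)
    rcases mem_or_mate_mem hμ' h8 with h9 | h9
    · exact absurd (hmap _ hy) (hs.mate_notMem hμ (h5.mem_iff.1 h9))
    · exact h9
  · have := h5.length_eq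
    simp at this; omega

/-- The existence of the wanted structure for all configurations of size less than `N`. -/
def TposyBelow (G : SimpleGraph V) (v : V) (N : ℕ) : Prop :=
  ∀ (μ : V → V) (a x y x' y' : V) (L t t' : List V), IsMate G μ → NN G μ a L (μ a) →
    Exit G μ (a :: L) x t y → Exit G μ ((a :: L).map μ) x' t' y' → 1 ≤ cov μ (a :: L) v →
    L.length + t.length + t'.length < N → HasTposy G v

/-- The white walk may still run into the cycle; replacing it by an exit does not lengthen it, so
the size bound survives. -/
theorem TposyBelow.hasTposy {a x y x' y' v : V} {L t t' : List V} {N : ℕ}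
    (ih : TposyBelow G v N) (hμ : IsMate G μ) (hc : NN G μ a L (μ a)) (hx : x ∈ a :: L)
    (ht : NN G μ x t y) (hy : y ∈ a :: L ∨ y ∈ t) (hs : Simple μ (a :: L ++ t))
    (hx' : μ x' ∈ a :: L) (ht' : NN G μ x' t' y') (hy' : μ y' ∈ a :: L ∨ y' ∈ t')
    (hs' : Simple μ t') (hv : 1 ≤ cov μ (a :: L) v)
    (hN : L.length + t.length + t'.length < N) : HasTposy G v := by
  have hsc : Simple μ ((a :: L).map μ) := fun z => by
    have := hs z
    rw [cov_append] at this
    rw [cov_map hμ]; omega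
  have hmap : ∀ z, μ z ∈ a :: L → z ∈ (a :: L).map μ :=
    fun z hz => List.mem_map.2 ⟨_, hz, hμ.invol z⟩
  obtain ⟨x3, t3, y3, e, e'⟩ := Exit.exists_of_walk hμ hsc (hmap _ hx') ht'
    (hy'.imp_left (hmap _)) hs'
  exact ih μ a x y x3 y3 L t t3 hμ hc ⟨hx, ht, hy, hs⟩ e hv (by omega)

/-- The white exit first meets the black exit so that a new alternating cycle arises. -/
theorem HasTposy.of_meet (hμ : IsMate G μ) {a x y x' y' v u : V} {L t A B : List V} {N : ℕ}
    (ih : TposyBelow G v N) (hc : NN G μ a L (μ a)) (he : Exit G μ (a :: L) x t y)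
    (he' : Exit G μ ((a :: L).map μ) x' (A ++ u :: B) y') (hv : 1 ≤ cov μ (a :: L) v)
    (hN : L.length + t.length + (A ++ u :: B).length ≤ N) (hu : μ u ∈ t)
    (hd : ∀ z, cov μ t z + cov μ A z ≤ 1) : HasTposy G v := by
  obtain ⟨μ', hμ', hag, h, l, q, hl, hq, ht, ht', hy, hy', hcov, hlen, hv'⟩ :=
    exists_orient_exits hμ hc he he' hv
  have hut : μ' u ∈ t := by rwa [hag u (by simp)]
  have hst : Simple μ' (h :: (l ++ q) ++ t) := fun z => by
    rw [cov_append, hcov, cov_congr fun z hz => hag z (Or.inl hz), ← cov_append]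
    exact he.simple z
  have hst' : Simple μ' (h :: (l ++ q) ++ (A ++ u :: B)) := fun z => by
    rw [cov_append, hcov, cov_congr fun z hz => hag z (Or.inr hz), ← cov_map hμ, ← cov_append]
    exact he'.simple z
  have hd' : ∀ z, cov μ' t z + cov μ' A z ≤ 1 := fun z => by
    rw [cov_congr fun z hz => hag z (Or.inl hz),
      cov_congr fun z hz => hag z (Or.inr (by simp [hz]))]
    exact hd z
  clear hd hu he he' hc hv hcov hag
  obtain ⟨w, hw⟩ : ∃ w, μ' u = w := ⟨_, rfl⟩
  have huw : u = μ' w := by rw [← hw, hμ'.invol]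
  rw [hw] at hut
  obtain ⟨t1, t2, rfl⟩ := List.append_of_mem hut
  obtain ⟨ht1, ht2⟩ := ht.split_cons
  obtain ⟨hA, hB⟩ := ht'.split_cons
  rw [hw] at hA
  -- The exits cross the shared matching edge in opposite directions, so the chosen arc, `t1`, this
  -- edge and `A` backwards close up to a cycle. The arc `q` is dropped, but is available for
  -- prolonging one exit.
  have hcyc : NN G μ' h (l ++ (t1 ++ w :: inv μ' A)) (μ' h) :=
    hl.append_nn (ht1.glue rfl (hA.inv hμ'))
  simp only [List.length_append, List.length_cons] at hN
  have hwu : ∀ z, hit μ' u z = hit μ' w z := fun z => by rw [huw, hit_mate hμ']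
  -- The shared edge was counted in both exits and is now counted once. The size therefore drops
  -- even if one exit is prolonged along `q`.
  have key : ∀ T y2 B' y2', NN G μ' w T y2 →
      (y2 ∈ h :: (l ++ (t1 ++ w :: inv μ' A)) ∨ y2 ∈ T) →
      (∀ z, cov μ' T z ≤ cov μ' t2 z + cov μ' q z) → NN G μ' u B' y2' →
      (μ' y2' ∈ h :: (l ++ (t1 ++ w :: inv μ' A)) ∨ y2' ∈ B') →
      (∀ z, cov μ' B' z ≤ cov μ' B z + cov μ' q z) →
      T.length + B'.length ≤ t2.length + B.length + q.length → HasTposy G v := by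
    intro T y2 B' y2' e1 e2 e3 e4 e5 e6 e7
    refine ih.hasTposy hμ' hcyc (x := w) (by simp) e1 e2 (fun z => ?_) (x' := u) (by simp [hw])
      e4 e5 (fun z => ?_) ?_ ?_
    · have h1 := hst z; have h2 := hst' z; have h3 := hd' z; have h4 := e3 z
      simp only [cov_append, cov_cons, cov_inv hμ'] at h1 h2 h3 h4 ⊢; omega
    · have h1 := hst' z; have h2 := e6 z
      simp only [cov_append, cov_cons] at h1 h2; omega
    · simp only [cov_append, cov_cons] at hv' ⊢; omega
    · simp [inv]; omega
  have hB' : μ' y' ∉ q → μ' y' ∈ h :: (l ++ (t1 ++ w :: inv μ' A)) ∨ y' ∈ B := fun hn => by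
    have e1 : y' = u → μ' y' = w := fun e => by rw [e, hw]
    have e2 : y' ∈ A → μ' y' ∈ inv μ' A := fun e => (mem_inv hμ').2 (by rwa [hμ'.invol])
    simp only [List.mem_cons, List.mem_append] at hy' ⊢
    clear * - hy' e1 e2 hn
    tauto
  -- An exit ending on `q` must be prolonged along it until it meets the new cycle. If both end
  -- there, they are ears and give a Tposy directly.
  by_cases hyq : y ∈ q
  · by_cases hyq' : μ' y' ∈ q
    · exact HasTposy.of_ears hμ' hl hq ht ht' hyq hyq' hst hst' hv'
    · obtain ⟨s, r, e, h1, -⟩ := hq.split_mem (List.mem_cons_of_mem _ hyq)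
      obtain ⟨T, h2, h3, h4⟩ := ht2.back hμ' h1
      refine key T x B y' h2 (Or.inl ?_) (fun z => ?_) hB (hB' hyq') (fun z => by omega) ?_
      · have := hl.mem
        clear * - this
        simp only [List.mem_cons, List.mem_append] at this ⊢; tauto
      · rw [h3, e, cov_append]; omega
      · rw [h4, e, List.length_append]; omega
  have hyT : y ∈ h :: (l ++ (t1 ++ w :: inv μ' A)) ∨ y ∈ t2 := by
    clear * - hy hyq
    simp only [List.mem_cons, List.mem_append] at hy ⊢; tauto
  by_cases hyq' : μ' y' ∈ q
  · obtain ⟨q1, q2, rfl⟩ := List.append_of_mem hyq'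
    refine key t2 y (B ++ μ' y' :: q2) (μ' h) ht2 hyT (fun z => by omega)
      (hB.glue (hμ'.invol y').symm hq.split_cons.2) (Or.inl (by simp [hμ'.invol])) (fun z => ?_) ?_
    · simp only [cov_append, cov_cons]; omega
    · simp; omega
  · exact key t2 y B y' ht2 hyT (fun z => by omega) hB (hB' hyq') (fun z => by omega) (by omega)

/-- The white exit first meets the stem of the black exit so that a blossom arises. -/
theorem HasTposy.of_meet_stem (hμ : IsMate G μ) {a x y x' y' v u : V} {L t1 t2 A B : List V}
    (hc : NN G μ a L (μ a)) (he : Exit G μ (a :: L) x (t1 ++ u :: t2) y)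
    (he' : Exit G μ ((a :: L).map μ) x' (A ++ u :: B) y') (hv : 1 ≤ cov μ (a :: L) v)
    (hy : y ∈ u :: t2) (hd : ∀ z, cov μ (t1 ++ u :: t2) z + cov μ A z ≤ 1) : HasTposy G v := by
  obtain ⟨μ', hμ', hag, h, l, q, hl, hq, ht, ht', -, -, hcov, -, hv'⟩ :=
    exists_orient_exits hμ hc he he' hv
  have hst : Simple μ' (h :: (l ++ q) ++ (t1 ++ u :: t2)) := fun z => by
    rw [cov_append, hcov, cov_congr fun z hz => hag z (Or.inl hz), ← cov_append]
    exact he.simple z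
  have hst' : Simple μ' (h :: (l ++ q) ++ (A ++ u :: B)) := fun z => by
    rw [cov_append, hcov, cov_congr fun z hz => hag z (Or.inr hz), ← cov_map hμ, ← cov_append]
    exact he'.simple z
  have hd' : ∀ z, cov μ' (t1 ++ u :: t2) z + cov μ' A z ≤ 1 := fun z => by
    rw [cov_congr fun z hz => hag z (Or.inl hz),
      cov_congr fun z hz => hag z (Or.inr (by simp [hz]))]
    exact hd z
  clear hd he he' hc hv hcov hag
  obtain ⟨ht1, ht2⟩ := ht.split_cons
  obtain ⟨hA, -⟩ := ht'.split_cons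
  obtain ⟨s, w, rfl, hs, hw⟩ := ht2.split_mem hy
  -- The path is the rest of the stem from the meeting edge on. The second blossom, based at `μ' u`,
  -- goes back along `A`, then through the arc with `v`, and returns along `t1`.
  refine ⟨μ', hμ', u, s, y, w, inv μ' A ++ h :: (l ++ t1), hs, hw,
    (hA.inv hμ').glue rfl (hl.append_nn ht1), fun z => ?_, fun z => ?_, ?_⟩
  · have := hst z
    simp only [cov_append, cov_cons] at *; omega
  · have := hst z; have := hst' z; have := hd' z
    simp only [cov_append, cov_cons, cov_inv hμ'] at *; omega
  · simp only [cov_append, cov_cons] at *; omega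

/-- If both exits first share a matching edge in opposite directions, `HasTposy.of_meet` applies. If
they share it in the same direction, reversing an ear, or the blossom of a flower, changes the
direction; on a stem `HasTposy.of_meet_stem` finishes. -/
theorem tposyBelow (G : SimpleGraph V) (v : V) (N : ℕ) : TposyBelow G v N := by
  induction N with
  | zero => intro μ a x y x' y' L t t' _ _ _ _ _ h; omega
  | succ N ih =>
  intro μ a x y x' y' L t t' hμ hc he he' hv hN
  by_cases hs : Simple μ (a :: L ++ t ++ t')
  · obtain ⟨μ', hμ', hag, h, l, q, hl, hq, ht, ht', hy, hy', hcov, -, hv'⟩ :=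
      exists_orient_exits hμ hc he he' hv
    refine HasTposy.of_disjoint hμ' hl hq ht ht' hy hy' (fun z => ?_) hv'
    rw [cov_append, cov_append, hcov, cov_congr fun z hz => hag z (Or.inl hz),
      cov_congr fun z hz => hag z (Or.inr hz), ← cov_append, ← cov_append]
    exact hs z
  obtain ⟨A, u, B, rfl, h1, h2⟩ := exists_first_hit he.simple hs hμ
  have hd : ∀ z, cov μ t z + cov μ A z ≤ 1 := fun z => by
    have := h1 z
    simp only [cov_append] at this; omega
  have hu : u ∈ t ∨ μ u ∈ t := by
    have h3 := he'.simple u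
    have h4 := hit_self (μ := μ) u
    have h5 : ¬ (u ∈ a :: L ∨ μ u ∈ a :: L) := fun h => by
      have : 1 ≤ cov μ (a :: L) u := h.elim cov_pos_of_mem (cov_pos_of_mate_mem hμ)
      rw [cov_append, cov_map hμ, cov_append, cov_cons u] at h3; omega
    have h6 : ¬ (u ∈ A ∨ μ u ∈ A) := fun h => by
      have : 1 ≤ cov μ A u := h.elim cov_pos_of_mem (cov_pos_of_mate_mem hμ)
      rw [cov_append, cov_map hμ, cov_append, cov_cons u] at h3; omega
    rw [List.mem_append, List.mem_append, List.mem_append, List.mem_append] at h2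
    tauto
  rcases hu with hu | hu
  · rcases he.closing with hy | hy
    · refine HasTposy.of_meet hμ ih hc (x := y) (t := inv μ t) (y := x)
        ⟨hy, he.walk.inv hμ, Or.inl he.mem, fun z => ?_⟩ he' hv ?_ ?_ ?_
      · rw [cov_append, cov_inv hμ, ← cov_append]; exact he.simple z
      · simp [inv] at hN ⊢; omega
      · rw [mem_inv hμ, hμ.invol]; exact hu
      · simpa only [cov_inv hμ] using hd
    · obtain ⟨s, w, rfl⟩ := List.append_of_mem hy
      obtain ⟨hs1, hw⟩ := he.walk.split_cons
      by_cases huw : u ∈ w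
      · refine HasTposy.of_meet hμ ih hc (x := x) (t := s ++ y :: inv μ w) (y := y)
          ⟨he.mem, hs1.glue rfl (hw.inv hμ), Or.inr (by simp), fun z => ?_⟩ he' hv ?_ ?_ ?_
        · have := he.simple z
          simp only [cov_append, cov_cons, cov_inv hμ] at *; omega
        · simp [inv] at hN ⊢; omega
        · simp [mem_inv hμ, hμ.invol, huw]
        · simpa only [cov_append, cov_cons, cov_inv hμ] using hd
      · by_cases huy : u = y
        · subst huy
          exact HasTposy.of_meet_stem hμ hc he he' hv (by simp) hd
        · have hus : u ∈ s := by
            simp only [List.mem_append, List.mem_cons] at hu; tauto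
          obtain ⟨s1, s2, rfl⟩ := List.append_of_mem hus
          rw [List.append_assoc, List.cons_append] at he hd
          exact HasTposy.of_meet_stem hμ hc he he' hv (by simp) hd
  · exact HasTposy.of_meet hμ ih hc he he' hv (by omega) hu hd

/-- If alternating walks starting and ending with non-matching edges lead from `v` to itself and
from the partner of `v` to itself, then `v` is as wanted. -/
theorem HasTposy.of_closed_walks (hμ : IsMate G μ) {v : V} {t t' : List V}
    (ht : NN G μ v t v) (ht' : NN G μ (μ v) t' (μ v)) : HasTposy G v := by
  have hs : Simple μ [v] := fun z => by
    simp only [cov_cons, cov_nil, hit]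
    split_ifs with h1 h2
    · exact absurd (h1.trans h2.symm) (hμ.adj v).ne
    all_goals omega
  have hs' : Simple μ ([v].map μ) := fun z => by rw [cov_map hμ]; exact hs z
  obtain ⟨t1, y1, h1, h2, h3⟩ := exists_simple_walk hμ ht
  obtain ⟨t1', y1', h1', h2', h3'⟩ := exists_simple_walk hμ ht'
  obtain ⟨x, s, y, e, -⟩ := Exit.exists_of_walk hμ hs (by simp) h1 (by simpa using h3) h2
  obtain ⟨x', s', y', e', -⟩ := Exit.exists_of_walk hμ hs' (by simp) h1' (by simpa using h3') h2'
  -- The initial cycle is the matching edge of `v`, traversed back and forth.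
  exact tposyBelow G v _ μ v x y x' y' [] s s' hμ (hμ.adj v) e e' (by simp [cov, hit])
    (Nat.lt_succ_self _)

end JposyGraphs

/-! ### From the Jposy to reachability in the implication digraph -/

namespace JposyGraphs

variable {V : Type*} {G : SimpleGraph V} {μ : V → V}

/-- The edges of the walk are alternately in `M` and not in `M`; the first one is in `M` if and
only if `b` is true. -/
def StepAlt (M : G.Subgraph) : ∀ {u v : V}, Bool → G.Walk u v → Prop
  | _, _, _, .nil => True
  | u, _, b, .cons (v := w) _ p => (M.Adj u w ↔ b = true) ∧ StepAlt M (!b) p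

theorem StepAlt.of_isAlternatingWalk {M : G.Subgraph} {u v : V} {p : G.Walk u v} {b : Bool}
    (h : IsAlternatingWalk M p) (hb : ∀ e ∈ p.edges.head?, (e ∈ M.edgeSet ↔ b = true)) :
    StepAlt M b p := by
  induction p generalizing b with
  | nil => trivial
  | cons hadj p ih =>
    have hb' := hb _ (by simp; rfl)
    refine ⟨hb', ih ?_ fun e he => ?_⟩
    · exact (List.isChain_cons.1 (show List.IsChain _ (_ :: p.edges) from h)).2
    · have := (List.isChain_cons.1 (show List.IsChain _ (_ :: p.edges) from h)).1 e he
      cases b <;> simp_all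

theorem StepAlt.isAlternatingWalk {M : G.Subgraph} {u v : V} {p : G.Walk u v} {b : Bool}
    (h : StepAlt M b p) : IsAlternatingWalk M p := by
  induction p generalizing b with
  | nil => exact List.IsChain.nil
  | @cons u w v hadj p ih =>
    refine List.isChain_cons.2 ⟨fun e he => ?_, ih h.2⟩
    cases p with
    | nil => simp at he
    | @cons _ w' _ hadj' p =>
      have h1 := h.1
      have h2 := h.2.1
      have he' : s(w, w') = e := by simpa using he
      subst he'
      change s(u, w) ∈ M.edgeSet ↔ _
      rw [SimpleGraph.Subgraph.mem_edgeSet, SimpleGraph.Subgraph.mem_edgeSet, h1, h2]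
      cases b <;> simp

section Lists

/-- Every `true` is followed by its own `false`. -/
theorem two_mul_count_le {L : List Bool} (h : L.IsChain fun a b => ¬(a = true ∧ b = true))
    (hl : ∀ x ∈ L.getLast?, x = false) : 2 * L.count true ≤ L.length := by
  induction hn : L.length using Nat.strong_induction_on generalizing L with
  | _ n ih =>
  match L, hn with
  | [], _ => simp
  | [a], _ => simp at hl; subst hl; simp
  | a :: b :: L, hn =>
    rw [List.isChain_cons_cons] at h
    simp only [List.length_cons] at hn
    cases a with
    | false =>
      have := ih (L.length + 1) (by omega) h.2 (by simpa using hl) rfl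
      simp at this ⊢; omega
    | true =>
      have hb : b = false := by simpa using h.1
      subst hb
      have h2 : L.IsChain fun a b => ¬(a = true ∧ b = true) := (List.isChain_cons.1 h.2).2
      have := ih L.length (by omega) h2 (fun x hx => hl x (by
        cases L with
        | nil => simp at hx
        | cons c L => simpa using hx)) rfl
      simp; omega

/-- A leading `false` would leave a tail with more `true` entries than the bound permits, so
equality forces `true, false` at the front, and again after it. -/
theorem isChain_ne_of_two_mul_count {L : List Bool}
    (h : L.IsChain fun a b => ¬(a = true ∧ b = true))
    (hl : ∀ x ∈ L.getLast?, x = false) (hc : 2 * L.count true = L.length) :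
    L.IsChain (· ≠ ·) ∧ ∀ x ∈ L.head?, x = true := by
  induction hn : L.length using Nat.strong_induction_on generalizing L with
  | _ n ih =>
  match L, hn with
  | [], _ => simp
  | [a], _ => simp at hl; subst hl; simp at hc
  | a :: b :: L, hn =>
    rw [List.isChain_cons_cons] at h
    simp only [List.length_cons] at hn
    cases a with
    | false =>
      have := two_mul_count_le h.2 (by simpa using hl)
      simp at this hc; omega
    | true =>
      have hb : b = false := by simpa using h.1
      subst hb
      have h2 : L.IsChain fun a b => ¬(a = true ∧ b = true) := (List.isChain_cons.1 h.2).2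
      have := ih L.length (by omega) h2 (fun x hx => hl x (by
        cases L with
        | nil => simp at hx
        | cons c L => simpa using hx)) (by simp at hc; omega) rfl
      refine ⟨?_, by simp⟩
      rw [List.isChain_cons_cons, List.isChain_cons]
      exact ⟨by simp, fun y hy => by simp [this.2 y hy], this.1⟩

end Lists

theorem isChain_edges_of_isTrail {M : G.Subgraph} (hM : M.IsMatching) {u v : V} {p : G.Walk u v}
    (hp : p.IsTrail) :
    p.edges.IsChain fun e f => ¬(e ∈ M.edgeSet ∧ f ∈ M.edgeSet) := by
  induction p with
  | nil => exact List.IsChain.nil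
  | @cons u w v hadj p ih =>
    rw [SimpleGraph.Walk.isTrail_cons] at hp
    refine List.isChain_cons.2 ⟨fun e he => ?_, ih hp.1⟩
    cases p with
    | nil => simp at he
    | @cons _ w' _ hadj' p =>
      have he' : s(w, w') = e := by simpa using he
      subst he'
      rintro ⟨h1, h2⟩
      change s(u, w) ∈ M.edgeSet at h1
      rw [SimpleGraph.Subgraph.mem_edgeSet] at h1 h2
      have := (hM h1.snd_mem).unique h1.symm h2
      subst this
      exact hp.2 (by simp [Sym2.eq_swap])

theorem mem_of_mem_getLast?_edges {u v : V} {p : G.Walk u v} {e : Sym2 V}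
    (he : e ∈ p.edges.getLast?) : v ∈ e := by
  induction p with
  | nil => simp at he
  | cons hadj p ih =>
    cases p with
    | nil => simp at he; simp [← he]
    | cons hadj' p => exact ih (by simpa using he)

/-- Both edges at the base are outside `M`. After dropping the first, `k` of the remaining `2 * k`
edges are in `M`, no two consecutive and not the last, and this extreme count forces alternation. -/
theorem IsBlossom.stepAlt {M : G.Subgraph} (hM : M.IsMatching) {b : V} {C : G.Walk b b}
    (hC : IsBlossom M C) : StepAlt M false C ∧ Odd C.length := by
  classical
  obtain ⟨hcyc, ⟨k, hk, hcard⟩, hbase⟩ := hC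
  refine ⟨?_, ⟨k, hk⟩⟩
  have hbe : ∀ e ∈ C.edges, b ∈ e → e ∉ M.edgeSet := by
    intro e he hb hm
    obtain ⟨c, rfl⟩ := hb
    exact hbase c (C.snd_mem_support_of_mem_edges he) hm
  have hhead : ∀ e ∈ C.edges.head?, e ∉ M.edgeSet := fun e he => by
    refine hbe e (List.mem_of_mem_head? he) ?_
    cases C with
    | nil => simp at he
    | cons h p => simp at he; simp [← he]
  have hlast : ∀ e ∈ C.edges.getLast?, e ∉ M.edgeSet := fun e he =>
    hbe e (List.mem_of_mem_getLast? he) (mem_of_mem_getLast?_edges he)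
  have hch := isChain_edges_of_isTrail hM hcyc.isTrail
  have hcount : C.edges.countP (fun e => decide (e ∈ M.edgeSet)) = k := by
    rw [← hcard, List.countP_eq_length_filter,
      ← List.toFinset_card_of_nodup (hcyc.isTrail.edges_nodup.filter _), ← Set.ncard_coe_finset]
    congr 1
    ext e; simp
  set E := C.edges with hE
  have hlen : E.length = 2 * k + 1 := by rw [hE, SimpleGraph.Walk.length_edges, hk]
  refine StepAlt.of_isAlternatingWalk ?_ (fun e he => by simpa using hhead e he)
  change E.IsChain _
  have key : (E.map fun e => decide (e ∈ M.edgeSet)).IsChain (· ≠ ·) := by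
    have hch' : (E.map fun e => decide (e ∈ M.edgeSet)).IsChain
        fun a b => ¬(a = true ∧ b = true) := by
      rw [List.isChain_map]; simpa using hch
    have hl' : ∀ x ∈ (E.map fun e => decide (e ∈ M.edgeSet)).getLast?, x = false := by
      intro x hx
      simp only [List.getLast?_map, Option.mem_def, Option.map_eq_some_iff] at hx
      obtain ⟨e, he, rfl⟩ := hx
      simpa using hlast e he
    cases hEc : E with
    | nil => simp
    | cons e E' =>
      rw [hEc] at hch' hl' hcount hlen hhead
      have he : decide (e ∈ M.edgeSet) = false := by simpa using hhead e (by simp)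
      simp only [List.map_cons, he] at hch' hl' ⊢
      have h1 := (List.isChain_cons.1 hch').2
      have h2 : ∀ x ∈ (E'.map fun e => decide (e ∈ M.edgeSet)).getLast?, x = false :=
        fun x hx => hl' x (by
          cases hE' : E'.map (fun e => decide (e ∈ M.edgeSet)) with
          | nil => rw [hE'] at hx; simp at hx
          | cons c L => rw [hE'] at hx; simpa using hx)
      obtain ⟨h3, h4⟩ := isChain_ne_of_two_mul_count h1 h2 (by
        rw [List.countP_cons, he] at hcount
        simp only [List.length_cons] at hlen
        rw [List.length_map, List.count, List.countP_map]
        have : (fun x => x == true) ∘ (fun e => decide (e ∈ M.edgeSet)) =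
          fun e => decide (e ∈ M.edgeSet) := by ext; simp
        rw [this]
        simp at hcount; omega)
      exact List.isChain_cons.2 ⟨fun y hy => by simp [h4 y hy], h3⟩
  rw [List.isChain_map] at key
  exact key.imp fun a b hab => by
    by_cases h1 : a ∈ M.edgeSet <;> by_cases h2 : b ∈ M.edgeSet <;> simp_all

/-- One step of the implication digraph: a non-matching edge, then a matching edge. -/
abbrev Reach (G : SimpleGraph V) (μ : V → V) : V → V → Prop :=
  Relation.ReflTransGen fun u w => G.Adj u (μ w)

/-- Skew symmetry: an arc read backwards is an arc between the partners, like a contrapositive. -/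
theorem Reach.mate (hμ : IsMate G μ) {u w : V} (h : Reach G μ u w) :
    Reach G μ (μ w) (μ u) := by
  induction h with
  | refl => exact .refl
  | tail _ h ih => exact .head (by rw [hμ.invol]; exact h.symm) ih

theorem Reach.exists_nm {u w : V} (h : Reach G μ u w) : ∃ l, NM G μ u l w := by
  induction h using Relation.ReflTransGen.head_induction_on with
  | refl => exact ⟨[], rfl⟩
  | head h _ ih => exact ih.imp' (_ :: ·) fun l hl => ⟨h, hl⟩

theorem Reach.exists_nn (hμ : IsMate G μ) {v : V} (h : Reach G μ v (μ v)) :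
    ∃ t, NN G μ v t v := by
  obtain ⟨l, hl⟩ := h.exists_nm
  rcases hl.last with ⟨-, e⟩ | ⟨m, -, hm⟩
  · exact absurd e (hμ.adj v).ne
  · exact ⟨m, by rwa [hμ.invol] at hm⟩

/-- Non-matching edges are arcs and matching edges only swap a vertex for its partner. Which of the
two represents an endpoint depends on whether the end edge is in the matching, hence on `b` and the
parity of the length. -/
theorem StepAlt.reach {M : G.Subgraph} (hμ : IsMate G μ) (hM : ∀ a b, M.Adj a b → μ a = b)
    {u v z : V} {p : G.Walk u v} {b : Bool} (h : StepAlt M b p) (hz : z ∈ p.support) :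
    ∃ ζ, (ζ = z ∨ ζ = μ z) ∧ Reach G μ (if b then μ u else u) ζ ∧
      Reach G μ ζ (if b = decide (Odd p.length) then v else μ v) := by
  induction p generalizing b z with
  | nil =>
    simp at hz; subst hz
    cases b
    · exact ⟨z, Or.inl rfl, .refl, by simpa using Relation.ReflTransGen.refl⟩
    · exact ⟨μ z, Or.inr rfl, .refl, by simpa using Relation.ReflTransGen.refl⟩
  | @cons u w v hadj p ih =>
    have hstep : Reach G μ (if b then μ u else u) (if !b then μ w else w) := by
      cases b
      · refine .single ?_
        simpa [hμ.invol] using hadj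
      · have := hM _ _ (h.1.2 rfl)
        simp [this, Relation.ReflTransGen.refl]
    have hpar : (b = decide (Odd (SimpleGraph.Walk.cons hadj p).length)) ↔
        ((!b) = decide (Odd p.length)) := by
      rw [SimpleGraph.Walk.length_cons]
      cases b <;> by_cases ho : Odd p.length <;> simp [ho, Nat.odd_add_one]
    simp only [hpar]
    rw [SimpleGraph.Walk.support_cons, List.mem_cons] at hz
    rcases hz with rfl | hz
    · obtain ⟨ζ, -, h1, h2⟩ := ih h.2 p.start_mem_support
      refine ⟨if b then μ z else z, ?_, .refl, hstep.trans (h1.trans h2)⟩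
      cases b <;> simp
    · obtain ⟨ζ, h0, h1, h2⟩ := ih h.2 hz
      exact ⟨ζ, h0, hstep.trans h1, h2⟩

theorem IsJposy.reach_mate {M : G.Subgraph} (hμ : IsMate G μ) (hM : ∀ a b, M.Adj a b → μ a = b)
    {a b v : V} {B₁ : G.Walk a a} {B₂ : G.Walk b b} {W : G.Walk a b} (h : IsJposy M B₁ B₂ W)
    (hv : v ∈ B₁.support ∨ v ∈ B₂.support ∨ v ∈ W.support) : Reach G μ v (μ v) := by
  obtain ⟨⟨hmat, -⟩, h1, h2, ⟨h3, h4, -⟩, h5⟩ := h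
  obtain ⟨hs1, ho1⟩ := h1.stepAlt hmat
  obtain ⟨hs2, ho2⟩ := h2.stepAlt hmat
  have hs3 : StepAlt M true W := StepAlt.of_isAlternatingWalk h3 fun e he => by
    obtain ⟨e', he', hm⟩ := h4
    have : e' = e := by simp only [Option.mem_def] at he he'; rw [he] at he'; simpa using he'.symm
    simpa [← this] using hm
  have r1 := fun z hz => hs1.reach hμ hM (z := z) hz
  have r2 := fun z hz => hs2.reach hμ hM (z := z) hz
  have r3 := fun z hz => hs3.reach hμ hM (z := z) hz
  simp only [ho1, ho2, h5, decide_true, if_true, if_false, Bool.false_eq_true] at r1 r2 r3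
  obtain ⟨_, -, e1, e2⟩ := r1 a B₁.start_mem_support
  obtain ⟨_, -, e3, e4⟩ := r2 b B₂.start_mem_support
  obtain ⟨_, -, e5, e6⟩ := r3 a W.start_mem_support
  have haa := e1.trans e2
  have hbb := e3.trans e4
  have hab := e5.trans e6
  have hba : Reach G μ (μ b) a := by
    have := Reach.mate hμ hab
    rwa [hμ.invol] at this
  have cyc : Reach G μ (μ a) a := hab.trans (hbb.trans hba)
  -- `a`, `μ a`, `b` and `μ b` lie on one closed digraph walk. Each vertex of the Jposy, or its
  -- partner, lies between two of them, and skew symmetry then brings in the other.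
  have main : ∃ ζ, (ζ = v ∨ ζ = μ v) ∧ Reach G μ a ζ ∧ Reach G μ ζ a := by
    rcases hv with hv | hv | hv
    · obtain ⟨ζ, h0, f1, f2⟩ := r1 v hv
      exact ⟨ζ, h0, f1, f2.trans cyc⟩
    · obtain ⟨ζ, h0, f1, f2⟩ := r2 v hv
      exact ⟨ζ, h0, haa.trans (hab.trans f1), f2.trans hba⟩
    · obtain ⟨ζ, h0, f1, f2⟩ := r3 v hv
      exact ⟨ζ, h0, haa.trans f1, f2.trans (hbb.trans hba)⟩
  obtain ⟨ζ, h0, f1, f2⟩ := main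
  rcases h0 with rfl | rfl
  · exact f2.trans (haa.trans (Reach.mate hμ f2))
  · have g1 := Reach.mate hμ f1
    have g2 := Reach.mate hμ f2
    rw [hμ.invol] at g1 g2
    exact g1.trans (cyc.trans f1)

end JposyGraphs

/-! ### From coded walks back to blossoms and Tposies -/

namespace JposyGraphs

variable {V : Type*} {G : SimpleGraph V} {μ : V → V}

/-- The perfect matching with partners given by `μ`. -/
def IsMate.subgraph (hμ : IsMate G μ) : G.Subgraph where
  verts := Set.univ
  Adj a b := μ a = b
  adj_sub h := h ▸ hμ.adj _
  edge_vert _ := Set.mem_univ _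
  symm := ⟨fun a b h => by rw [← h, hμ.invol]⟩

theorem IsMate.isPerfectMatching (hμ : IsMate G μ) : hμ.subgraph.IsPerfectMatching :=
  SimpleGraph.Subgraph.isPerfectMatching_iff.2 fun v => ⟨μ v, rfl, fun _ h => Eq.symm h⟩

theorem exists_isMate {M : G.Subgraph} (hM : M.IsPerfectMatching) :
    ∃ μ, IsMate G μ ∧ ∀ a b, M.Adj a b → μ a = b := by
  have h := SimpleGraph.Subgraph.isPerfectMatching_iff.1 hM
  choose μ h1 h2 using h
  exact ⟨μ, ⟨fun x => (h2 _ _ (h1 x).symm).symm, fun x => M.adj_sub (h1 x)⟩,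
    fun a b hab => (h2 a b hab).symm⟩

/-- Twice the number of edges is the sum of the degrees, which are at most one in any matching and
at least one in a perfect one. -/
theorem isMaximumMatching_of_isPerfectMatching [Finite V] {M : G.Subgraph}
    (hM : M.IsPerfectMatching) : IsMaximumMatching M := by
  classical
  refine ⟨hM.1, fun M' hM' => ?_⟩
  have := Fintype.ofFinite V
  have card : ∀ N : G.Subgraph, 2 * N.edgeSet.ncard = ∑ v, N.spanningCoe.degree v := fun N => by
    rw [N.spanningCoe.sum_degrees_eq_twice_card_edges, ← Set.ncard_coe_finset,
      SimpleGraph.coe_edgeFinset]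
    rfl
  have h1 : ∀ v, M'.spanningCoe.degree v ≤ 1 := fun v => by
    rw [← SimpleGraph.card_neighborFinset_eq_degree, Finset.card_le_one]
    intro a ha b hb
    rw [SimpleGraph.mem_neighborFinset] at ha hb
    exact hM'.eq_of_adj_left ha hb
  have h2 : ∀ v, 1 ≤ M.spanningCoe.degree v := fun v => by
    obtain ⟨w, hw, -⟩ := SimpleGraph.Subgraph.isPerfectMatching_iff.1 hM v
    rw [← SimpleGraph.card_neighborFinset_eq_degree, Finset.one_le_card]
    exact ⟨w, by rw [SimpleGraph.mem_neighborFinset]; exact hw⟩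
  have h3 := Finset.sum_le_sum fun v (_ : v ∈ Finset.univ) => (h1 v).trans (h2 v)
  rw [← card, ← card] at h3
  omega

/-- The endpoints of the matching edges of a list, in the order of the walk. -/
def ends (μ : V → V) (t : List V) : List V := t.flatMap fun u => [μ u, u]

theorem count_ends [DecidableEq V] (t : List V) (z : V) : (ends μ t).count z = cov μ t z := by
  induction t with
  | nil => rfl
  | cons u t ih =>
    have : ends μ (u :: t) = μ u :: u :: ends μ t := rfl
    rw [this, cov_cons, ← ih]
    simp only [hit, List.count_cons, beq_iff_eq]; omega

theorem mem_ends [DecidableEq V] {t : List V} {z : V} : z ∈ ends μ t ↔ 1 ≤ cov μ t z := by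
  rw [← count_ends, ← List.count_pos_iff]; rfl

theorem length_ends (t : List V) : (ends μ t).length = 2 * t.length := by
  induction t with
  | nil => rfl
  | cons u t ih =>
    have : ends μ (u :: t) = μ u :: u :: ends μ t := rfl
    rw [this]; simp [ih]; omega

/-- The coded walk only asks for adjacency. A step from `x` to `μ u` could be a matching edge only
if `x = u`, which distinctness excludes; `hy` excludes it for the last edge. -/
theorem NN.exists_walk (hμ : IsMate G μ) {x y : V} {t : List V} (h : NN G μ x t y)
    (hnd : (x :: t).Nodup) (hy : ∀ z ∈ x :: t, μ z ≠ y) :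
    ∃ w : G.Walk x y, w.support = x :: (ends μ t ++ [y]) ∧ StepAlt hμ.subgraph false w := by
  induction t generalizing x with
  | nil =>
    refine ⟨.cons h .nil, rfl, ?_, trivial⟩
    have : ¬ μ x = y := hy x (by simp)
    simpa [IsMate.subgraph] using this
  | cons u t ih =>
    obtain ⟨w, h1, h2⟩ := ih h.2 (List.nodup_cons.1 hnd).2
      fun z hz => hy z (List.mem_cons_of_mem _ hz)
    refine ⟨.cons h.1 (.cons (hμ.adj u).symm w), ?_, ?_, ?_, h2⟩
    · simp [h1, ends]
    · have : ¬ μ x = μ u := fun e => by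
        have := congrArg μ e
        rw [hμ.invol, hμ.invol] at this
        subst this; simp at hnd
      simpa [IsMate.subgraph] using this
    · simp [IsMate.subgraph, hμ.invol]

theorem NM.exists_walk (hμ : IsMate G μ) {x y : V} {t : List V} (h : NM G μ x t y)
    (hnd : (x :: t).Nodup) :
    ∃ w : G.Walk x y, w.support = x :: ends μ t ∧ StepAlt hμ.subgraph false w := by
  induction t generalizing x with
  | nil => cases h; exact ⟨.nil, rfl, trivial⟩
  | cons u t ih =>
    obtain ⟨w, h1, h2⟩ := ih h.2 (List.nodup_cons.1 hnd).2
    refine ⟨.cons h.1 (.cons (hμ.adj u).symm w), ?_, ?_, ?_, h2⟩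
    · simp [h1, ends]
    · have : ¬ μ x = μ u := fun e => by
        have := congrArg μ e
        rw [hμ.invol, hμ.invol] at this
        subst this; simp at hnd
      simpa [IsMate.subgraph] using this
    · simp [IsMate.subgraph, hμ.invol]

theorem StepAlt.mem_getLast? {M : G.Subgraph} {u v : V} {p : G.Walk u v} {b : Bool}
    (h : StepAlt M b p) (hp : 0 < p.length) :
    ∃ e ∈ p.edges.getLast?, (e ∈ M.edgeSet ↔ b = decide (Odd p.length)) := by
  induction p generalizing b with
  | nil => simp at hp
  | @cons u w v hadj p ih =>
    cases p with
    | nil => exact ⟨s(u, w), by simp, by simpa using h.1⟩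
    | cons hadj' p =>
      obtain ⟨e, h1, h2⟩ := ih h.2 (by simp)
      refine ⟨e, by simpa using h1, h2.trans ?_⟩
      rw [SimpleGraph.Walk.length_cons (p := SimpleGraph.Walk.cons hadj' p)]
      generalize (SimpleGraph.Walk.cons hadj' p).length = n
      cases b <;> by_cases ho : Odd n <;> simp [ho, Nat.odd_add_one]

theorem StepAlt.countP_edges {M : G.Subgraph} [DecidablePred (· ∈ M.edgeSet)] {u v : V}
    {p : G.Walk u v} {b : Bool} (h : StepAlt M b p) :
    p.edges.countP (· ∈ M.edgeSet) = (p.length + b.toNat) / 2 := by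
  induction p generalizing b with
  | nil => cases b <;> simp
  | @cons u w v hadj p ih =>
    rw [SimpleGraph.Walk.edges_cons, List.countP_cons, ih h.2, SimpleGraph.Walk.length_cons]
    have h1 := h.1
    rw [← SimpleGraph.Subgraph.mem_edgeSet] at h1
    simp only [decide_eq_true_eq, h1]
    cases b <;> simp; omega

/-- A closed alternating walk starting and ending with a non-matching edge, all of whose matching
edges are distinct, is a blossom. -/
theorem NN.exists_blossom [DecidableEq V] (hμ : IsMate G μ) {x : V} {t : List V}
    (h : NN G μ x t x) (hs : Simple μ (x :: t)) :
    ∃ C : G.Walk x x, C.support = x :: (ends μ t ++ [x]) ∧ IsBlossom hμ.subgraph C := by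
  obtain ⟨C, h1, h2⟩ := h.exists_walk hμ hs.nodup fun z hz e =>
    hs.mate_notMem hμ hz (by rw [e]; simp)
  have hlen : C.length = 2 * t.length + 1 := by
    have := C.length_support
    rw [h1] at this
    simp [length_ends] at this; omega
  have hnd : (ends μ t ++ [x]).Nodup := List.nodup_iff_count_le_one.2 fun z => by
    have h3 := hs z
    rw [List.count_append, count_ends]
    simp only [cov_cons, hit, List.count_singleton, beq_iff_eq] at h3 ⊢
    omega
  have hcyc : C.IsCycle := by
    cases t with
    | nil => exact absurd h (G.loopless.irrefl x)
    | cons u t =>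
      cases C with
      | nil => simp at hlen
      | cons hadj p =>
        have hp : p.support = ends μ (u :: t) ++ [x] := by simpa using h1
        rw [SimpleGraph.Walk.cons_isCycle_iff]
        have hpp : p.IsPath := SimpleGraph.Walk.IsPath.mk' (hp ▸ hnd)
        -- The first edge cannot recur: the second edge leads to `u`, which is not `x`, and the path
        -- `p` never returns to its own start.
        refine ⟨hpp, fun hmem => ?_⟩
        cases p with
        | nil => simp [ends] at hp
        | @cons _ w _ hadj' p =>
          have hp' : p.support = u :: (ends μ t ++ [x]) := by
            simp only [SimpleGraph.Walk.support_cons, ends, List.flatMap_cons, List.cons_append,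
              List.nil_append, List.cons.injEq] at hp
            exact hp.2
          have hw : w = u := by
            have := p.cons_tail_support
            rw [hp'] at this
            exact (List.cons.inj this).1
          have hxu : x ≠ u := by have := hs.nodup; simp at this; tauto
          rw [SimpleGraph.Walk.cons_isPath_iff] at hpp
          rw [SimpleGraph.Walk.edges_cons, List.mem_cons] at hmem
          rcases hmem with e | e
          · rcases Sym2.eq_iff.1 e with ⟨e, -⟩ | ⟨e, -⟩
            · exact hadj.ne e
            · exact hxu (e.trans hw)
          · exact hpp.2 (p.snd_mem_support_of_mem_edges e)
  refine ⟨C, h1, hcyc, ⟨t.length, hlen, ?_⟩, fun v hv hadj => ?_⟩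
  · classical
    have := h2.countP_edges
    rw [hlen] at this
    simp only [Bool.toNat_false] at this
    rw [show t.length = (2 * t.length + 1 + 0) / 2 by omega, ← this, List.countP_eq_length_filter,
      ← List.toFinset_card_of_nodup (hcyc.isTrail.edges_nodup.filter _), ← Set.ncard_coe_finset]
    congr 1
    ext e; simp
  · have hv' : μ x = v := hadj
    rw [h1, ← hv'] at hv
    have h3 := hs (μ x)
    have h4 := hit_mate_self (μ := μ) x
    have h5 := (hμ.adj x).ne'
    simp only [List.mem_cons, List.mem_append, h5, List.not_mem_nil, or_false, false_or,
      mem_ends] at hv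
    rw [cov_cons] at h3
    omega

theorem HasTposy.memTposy [Finite V] [DecidableEq V] {v : V} (h : HasTposy G v) :
    ∃ M : G.Subgraph, IsMaximumMatching M ∧ MemTposy M v := by
  obtain ⟨μ, hμ, h, l, x, w, z, hl, hw, hz, hs1, hs2, hv⟩ := h
  have hmax := isMaximumMatching_of_isPerfectMatching hμ.isPerfectMatching
  have hxl := fun y => hit_le_cov (μ := μ) hl.mem y
  obtain ⟨C, hC, hCb⟩ := hw.exists_blossom hμ fun y => by
    have h1 := hs1 y; have h2 := hxl y
    simp only [cov_append, cov_cons] at h1 h2 ⊢; omega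
  obtain ⟨D, hD, hDb⟩ := hz.exists_blossom hμ fun y => by
    have h1 := hs2 y
    simp only [cov_append, cov_cons, hit_mate hμ] at h1 ⊢; omega
  have hsl : Simple μ (h :: l) := fun y => by
    have h1 := hs1 y
    rw [cov_append] at h1; omega
  obtain ⟨P, hP, hPa⟩ := hl.exists_walk hμ hsl.nodup
  let Q : G.Walk (μ h) x := .cons (hμ.adj h).symm P
  have hQ : Q.support = ends μ (h :: l) := by
    change μ h :: P.support = _
    rw [hP]; rfl
  have hQa : StepAlt hμ.subgraph true Q := ⟨by simp [IsMate.subgraph, hμ.invol], hPa⟩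
  have hQo : Odd Q.length := by
    have := Q.length_support
    rw [hQ, length_ends] at this
    exact ⟨l.length, by simp at this; omega⟩
  have off : ∀ y, 1 ≤ cov μ (h :: l) y → y ≠ μ h → y ≠ x → y ∉ D.support ∧ y ∉ C.support := by
    intro y h1 h2 h3
    have h4 := hs1 y
    have h5 := hs2 y
    rw [cov_append] at h4 h5
    rw [hC, hD]
    simp only [List.mem_cons, List.mem_append, mem_ends, h2, h3, List.not_mem_nil,
      or_false, false_or]
    omega
  refine ⟨hμ.subgraph, hmax, μ h, x, D, C, Q, ⟨⟨hmax, hDb, hCb, fun e => ?_, ?_, ⟨?_, ?_, ?_⟩,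
    hQo⟩, fun y hy h1 h2 => ?_⟩, ?_⟩
  -- The blossoms differ because `μ h` is the base of `D`, whereas `C` meets the path only in `x`.
  · have h1 : μ h ∈ C.toSubgraph.verts := e ▸ D.start_mem_verts_toSubgraph
    rw [SimpleGraph.Walk.mem_verts_toSubgraph, hC] at h1
    have h2 : μ h ≠ x := fun e => hsl.mate_notMem hμ (z := h) (by simp) (by rw [e]; exact hl.mem)
    have h3 := hs1 (μ h)
    have h4 := hit_mate_self (μ := μ) h
    simp only [List.mem_cons, List.mem_append, h2, List.not_mem_nil, or_false, false_or,
      mem_ends] at h1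
    rw [cov_append, cov_cons] at h3
    omega
  · refine SimpleGraph.Walk.IsPath.mk' ?_
    rw [hQ]
    exact List.nodup_iff_count_le_one.2 fun y => by rw [count_ends]; exact hsl y
  · exact hQa.isAlternatingWalk
  · exact ⟨s(μ h, h), by simp [Q], by simp [IsMate.subgraph, hμ.invol]⟩
  · obtain ⟨e, h1, h2⟩ := hQa.mem_getLast? (by simp [Q])
    exact ⟨e, h1, h2.2 (by simp [hQo])⟩
  · rw [hQ, mem_ends] at hy
    exact off y hy h1 h2
  · rw [hQ, hC, hD, mem_ends]
    simp only [List.mem_cons, List.mem_append, mem_ends]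
    rw [cov_append, cov_append] at hv
    omega

end JposyGraphs

theorem mainTheorem2 {V : Type*} [Finite V] (G : SimpleGraph V)
    (hG : JposyGraphs.IsJposyGraph G) (v : V) :
    ∃ M : G.Subgraph, JposyGraphs.IsMaximumMatching M ∧ JposyGraphs.MemTposy M v := by
  classical
  obtain ⟨M, hM, a, b, B₁, B₂, W, hJ, hcov, -⟩ := hG
  obtain ⟨μ, hμ, hMμ⟩ := JposyGraphs.exists_isMate hM
  have h1 := hJ.reach_mate hμ hMμ (hcov v)
  have h2 := hJ.reach_mate hμ hMμ (hcov (μ v))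
  obtain ⟨t, ht⟩ := h1.exists_nn hμ
  obtain ⟨t', ht'⟩ := h2.exists_nn hμ
  exact (JposyGraphs.HasTposy.of_closed_walks hμ ht ht').memTposy
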